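/- For $N\ge 2$ let $\mathcal X_N$ be the set of symmetric $N\times N$ real matrices with entries in $[0,1]$ and zeros on the diagonal. For $p\in(0,1)$, $x\in[0,1]$ put $I_p(x)=x\log\frac xp+(1-x)\log\frac{1-x}{1-p}$ (with $0\log 0=0$), and $I_p(X)=\sum_{1\le i<j\le N}I_p(x_{ij})$ for $X=(x_{ij})\in\mathcal X_N$. For a symmetric matrix $X$ with eigenvalues $\lambda_1(X),\dots,\lambda_N(X)$ and $\alpha\in[1,\infty)$ let $\|X\|_{S_\alpha}=\big(\sum_{j=1}^N|\lambda_j(X)|^\alpha\big)^{1/\alpha}$, and for $r\in\mathbb R$ define $$\phi_\alpha(N,p,r)=\inf\{I_p(X):X\in\mathcal X_N,\ \|X\|_{S_\alpha}\ge r\},\qquad \psi_\alpha(N,p,r)=\inf\{I_p(X):X\in\mathcal X_N,\ \|X\|_{S_\alpha}\le r\},$$ where $\inf\emptyset=+\infty$ and $e^{-\infty}=0$. Let $A$ denote the adjacency matrix of the Erd\H{o}s--R\'enyi random graph $G(N,p)$. All asymptotic notation is for $N\to\infty$; $f\ll g$ means $f/g\to0$, and the rates in the $o(\cdot)$ terms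 may depend on $\alpha$, $s$ and the sequence $p=p(N)$. Fix a real $\alpha\in(2,\infty)$ and let $p=p(N)\in(0,1)$ with $p\ll1$. (Upper tail) If $$p\gg\max\bigg(N^{\frac2\alpha-1},\ \frac{(\log N)^{\frac{\alpha}{2\alpha-4}}}{\sqrt N}\bigg),$$ then for any fixed $s>1$, $$\mathbb P\big(\|A\|_{S_\alpha}\ge sNp\big)\le\exp\Big(-\phi_\alpha\big(N,p,(s-o(1))Np\big)+o\big(N^2p^2\log(1/p)\big)\Big).$$ (Lower tail) If $$p\gg\Big(\frac{\log N}{N}\Big)^{\frac{\alpha-2}{2\alpha-2}},$$ then for any fixed $0\le s<1$, $$\mathbb P\big(\|A\|_{S_\alpha}\le sNp\big)\le\exp\Big(-\psi_\alpha\big(N,p,(s+o(1))Np\big)+o(N^2p)\Big).$$ -/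

import Mathlib

open Filter Asymptotics Topology

noncomputable section

namespace SchattenLD

/-- The set `𝒳_N` of symmetric `N × N` matrices with entries in `[0,1]` and zero diagonal. -/
def cX (N : ℕ) : Set (Matrix (Fin N) (Fin N) ℝ) :=
  {X | X.IsSymm ∧ (∀ i, X i i = 0) ∧ ∀ i j, X i j ∈ Set.Icc (0 : ℝ) 1}

theorem isHermitian_of_mem_cX {N : ℕ} {X : Matrix (Fin N) (Fin N) ℝ} (hX : X ∈ cX N) :
    X.IsHermitian := by
  rw [Matrix.IsHermitian, Matrix.conjTranspose_eq_transpose_of_trivial]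
  exact hX.1

/-- The Schatten norm `(∑ⱼ |λⱼ(X)|^α)^(1/α)` of a real symmetric matrix, for finite `α`. -/
def schattenNorm (α : ℝ) {N : ℕ} {X : Matrix (Fin N) (Fin N) ℝ} (hX : X.IsHermitian) : ℝ :=
  (∑ j, |hX.eigenvalues j| ^ α) ^ (1 / α)

/-- The Schatten norm as a function on `𝒳_N`. -/
def schattenFun (α : ℝ) (N : ℕ) : cX N → ℝ :=
  fun X => schattenNorm α (isHermitian_of_mem_cX X.2)

/-- Relative entropy of Bernoulli(`x`) with respect to Bernoulli(`p`); as `0 * Real.log 0 = 0`,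
the convention `0 log 0 = 0` is built in. -/
def relEnt (p x : ℝ) : ℝ :=
  x * Real.log (x / p) + (1 - x) * Real.log ((1 - x) / (1 - p))

/-- `I_p(X) = ∑_{i<j} I_p(x_{ij})`. -/
def matEnt (p : ℝ) {N : ℕ} (X : Matrix (Fin N) (Fin N) ℝ) : ℝ :=
  ∑ i, ∑ j ∈ Finset.Ioi i, relEnt p (X i j)

/-- Upper tail variational problem `inf {I_p(X) : X ∈ 𝒳_N, h(X) ≥ t}`; the infimum is taken in the
extended reals, so it is `+∞` if no `X` is feasible. -/
def phi {N : ℕ} (h : cX N → ℝ) (p t : ℝ) : EReal :=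
  ⨅ (X : cX N) (_ : t ≤ h X), (matEnt p (X : Matrix (Fin N) (Fin N) ℝ) : EReal)

/-- Lower tail variational problem `inf {I_p(X) : X ∈ 𝒳_N, h(X) ≤ t}`; the infimum is taken in the
extended reals, so it is `+∞` if no `X` is feasible. -/
def psi {N : ℕ} (h : cX N → ℝ) (p t : ℝ) : EReal :=
  ⨅ (X : cX N) (_ : h X ≤ t), (matEnt p (X : Matrix (Fin N) (Fin N) ℝ) : EReal)

open Classical in
/-- The adjacency matrix of a graph on `[N]`, as an element of `𝒳_N`. -/
def adj {N : ℕ} (G : SimpleGraph (Fin N)) : cX N :=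
  ⟨G.adjMatrix ℝ, G.isSymm_adjMatrix, fun i => by simp, fun i j => by
    rw [SimpleGraph.adjMatrix_apply]; split_ifs <;> simp⟩

end SchattenLD

end

/-! Both bounds come from covering by convex sets. Given that the random indicator vector lies in a
convex set `K`, its conditional mean `x` also lies in `K`, and Jensen's inequality gives P(K) ≤
exp(-I_p(x)) (`exists_mem_Pr_le_exp_neg`). Schatten balls are convex. So if, off a negligible event,
the adjacency matrix A lies in one of exp(o(rate)) balls of radius δ = o(Np), each ball meeting the
tail event costs at least the infimum of I_p over a 2δ-relaxation of that event (`Pr_cover_le`).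

The balls come from truncating the spectrum (`exists_netMat_close`). A symmetric matrix of
Hilbert–Schmidt norm at most R has at most R²/τ² eigenvalues larger than τ in modulus. The
corresponding low-rank part is discretized with log-cardinality O(R²τ⁻² N log N); the rest has
Schatten norm at most (τ^(α-2) R²)^(1/α), because α ≥ 2.

For the lower tail this applies to A itself: by Chernoff there are fewer than 2N²p edges up to
probability exp(-N²p), so R² = 4N²p. The exceptional event is harmless because the zero matrix shows
ψ ≤ N²p.

For the upper tail the rate N²p² log(1/p) is too small for that, so A is first compared with its
mean. Trace moments show that the ball around the mean of radius of order N^(1/α) √(Np) has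
probability at least 1/2 (`half_le_Pr_schattenNorm_le`). Talagrand's inequality (`talagrand`) then
puts A within Hilbert–Schmidt distance R of this ball, R² a large multiple of the rate; a planted
clique shows that φ is at most a multiple of the rate, so the exceptional event is again harmless.
The two terms in the hypothesis on p make the radius of the ball o(Np), and allow a choice of τ for
which entropy and truncation error are both negligible. -/

namespace SchattenLD

/-! ### The Bernoulli product measure on finite sets and the entropy bound for convex sets -/

section Cube

variable {ι : Type*} [DecidableEq ι]

/-- The probability that a `p`-random subset of `s` equals `T`. -/
noncomputable def wt (p : ℝ) (s T : Finset ι) : ℝ := p ^ T.card * (1 - p) ^ (s \ T).card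

/-- The indicator vector of a finite set. -/
noncomputable def ind (T : Finset ι) : ι → ℝ := fun i => if i ∈ T then 1 else 0

/-- The probability that a `p`-random subset of `s` satisfies `Q`. -/
noncomputable def Pr (p : ℝ) (s : Finset ι) (Q : Finset ι → Prop) : ℝ :=
  open Classical in ∑ T ∈ s.powerset with Q T, wt p s T

theorem wt_nonneg {p : ℝ} (hp0 : 0 < p) (hp1 : p < 1) (s T : Finset ι) : 0 ≤ wt p s T := by
  have : 0 < 1 - p := by linarith
  unfold wt; positivity

theorem wt_pos {p : ℝ} (hp0 : 0 < p) (hp1 : p < 1) (s T : Finset ι) : 0 < wt p s T := by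
  have : 0 < 1 - p := by linarith
  unfold wt; positivity

theorem Pr_nonneg {p : ℝ} (hp0 : 0 < p) (hp1 : p < 1) (s : Finset ι) (Q : Finset ι → Prop) :
    0 ≤ Pr p s Q :=
  Finset.sum_nonneg fun T _ => wt_nonneg hp0 hp1 s T

theorem Pr_mono {p : ℝ} (hp0 : 0 < p) (hp1 : p < 1) {s : Finset ι} {Q Q' : Finset ι → Prop}
    (h : ∀ T ⊆ s, Q T → Q' T) : Pr p s Q ≤ Pr p s Q' := by
  classical
  unfold Pr
  refine Finset.sum_le_sum_of_subset_of_nonneg ?_ fun T _ _ => wt_nonneg hp0 hp1 s T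
  intro T hT
  simp only [Finset.mem_filter, Finset.mem_powerset] at hT ⊢
  exact ⟨hT.1, h T hT.1 hT.2⟩

theorem Pr_or_le {p : ℝ} (hp0 : 0 < p) (hp1 : p < 1) (s : Finset ι) (Q Q' : Finset ι → Prop) :
    Pr p s (fun T => Q T ∨ Q' T) ≤ Pr p s Q + Pr p s Q' := by
  classical
  unfold Pr
  simp only [Finset.sum_filter]
  rw [← Finset.sum_add_distrib]
  refine Finset.sum_le_sum fun T _ => ?_
  have := wt_nonneg hp0 hp1 s T
  by_cases h1 : Q T <;> by_cases h2 : Q' T <;> simp [h1, h2, this]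

theorem Pr_exists_le {p : ℝ} (hp0 : 0 < p) (hp1 : p < 1) (s : Finset ι) {Z : Type*} [Fintype Z]
    (Q : Z → Finset ι → Prop) :
    Pr p s (fun T => ∃ z, Q z T) ≤ ∑ z, Pr p s (Q z) := by
  classical
  unfold Pr
  simp only [Finset.sum_filter]
  rw [Finset.sum_comm]
  refine Finset.sum_le_sum fun T _ => ?_
  have := wt_nonneg hp0 hp1 s T
  split_ifs with h
  · obtain ⟨z, hz⟩ := h
    refine le_trans (by simp [hz]) (Finset.single_le_sum
      (f := fun z => if Q z T then wt p s T else 0) ?_ (Finset.mem_univ z))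
    intro z _
    split_ifs <;> simp [this]
  · exact Finset.sum_nonneg fun z _ => by split_ifs <;> simp [this]

theorem Pr_add_Pr_not (p : ℝ) (s : Finset ι) (Q : Finset ι → Prop) :
    Pr p s Q + Pr p s (fun T => ¬ Q T) = ∑ T ∈ s.powerset, wt p s T := by
  classical
  unfold Pr
  rw [← Finset.sum_filter_add_sum_filter_not s.powerset Q]
  congr!

/-- Expectation of a product over the coordinates of a random subset. -/
theorem sum_wt_mul_prod (p : ℝ) (s : Finset ι) (a b : ι → ℝ) :
    ∑ T ∈ s.powerset, wt p s T * ∏ i ∈ s, (if i ∈ T then a i else b i) =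
      ∏ i ∈ s, (p * a i + (1 - p) * b i) := by
  rw [Finset.prod_add]
  refine Finset.sum_congr rfl fun T hT => ?_
  rw [Finset.mem_powerset] at hT
  rw [Finset.prod_mul_distrib, Finset.prod_mul_distrib, Finset.prod_const, Finset.prod_const, wt]
  have : ∏ i ∈ s, (if i ∈ T then a i else b i) = (∏ i ∈ T, a i) * ∏ i ∈ s \ T, b i := by
    rw [← Finset.prod_sdiff hT, mul_comm]
    congr 1
    · exact Finset.prod_congr rfl fun i hi => by simp [hi]
    · exact Finset.prod_congr rfl fun i hi => by simp [(Finset.mem_sdiff.1 hi).2]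
  rw [this]; ring

theorem sum_wt (p : ℝ) (s : Finset ι) : ∑ T ∈ s.powerset, wt p s T = 1 := by
  have := sum_wt_mul_prod p s (fun _ => 1) (fun _ => 1)
  simpa using this

theorem wt_eq_prod (p : ℝ) {s T : Finset ι} (hT : T ⊆ s) :
    wt p s T = ∏ i ∈ s, (if i ∈ T then p else 1 - p) := by
  rw [wt, ← Finset.prod_sdiff hT, mul_comm]
  congr 1
  · rw [← Finset.prod_const]
    exact Finset.prod_congr rfl fun i hi => by simp [(Finset.mem_sdiff.1 hi).2]
  · rw [← Finset.prod_const]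
    exact Finset.prod_congr rfl fun i hi => by simp [hi]

theorem Pr_le_of_markov {p : ℝ} (hp0 : 0 < p) (hp1 : p < 1) (s : Finset ι) (f : Finset ι → ℝ)
    (hf : ∀ T ⊆ s, 0 ≤ f T) {c : ℝ} (hc : 0 < c) :
    Pr p s (fun T => c ≤ f T) ≤ (∑ T ∈ s.powerset, wt p s T * f T) / c := by
  classical
  rw [le_div_iff₀ hc, Pr, Finset.sum_mul, Finset.sum_filter]
  refine Finset.sum_le_sum fun T hT => ?_
  have h0 := wt_nonneg hp0 hp1 s T
  split_ifs with h
  · exact mul_le_mul_of_nonneg_left h h0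
  · exact mul_nonneg h0 (hf T (Finset.mem_powerset.1 hT))

/-- Chernoff bound for the number of elements of a random subset. -/
theorem Pr_card_ge_le {p : ℝ} (hp0 : 0 < p) (hp1 : p < 1) (s : Finset ι) (c : ℝ) :
    Pr p s (fun T => c ≤ T.card) ≤ Real.exp (2 * p * s.card - c) := by
  have h1 : Pr p s (fun T => c ≤ T.card) ≤ Pr p s (fun T => Real.exp c ≤ Real.exp T.card) :=
    Pr_mono hp0 hp1 fun T _ h => Real.exp_le_exp.2 h
  refine h1.trans ((Pr_le_of_markov hp0 hp1 s _ (fun T _ => (Real.exp_pos _).le)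
    (Real.exp_pos c)).trans ?_)
  rw [Real.exp_sub]
  refine div_le_div_of_nonneg_right ?_ (Real.exp_pos c).le
  have h2 : ∑ T ∈ s.powerset, wt p s T * Real.exp T.card =
      ∏ i ∈ s, (p * Real.exp 1 + (1 - p) * 1) := by
    rw [← sum_wt_mul_prod]
    refine Finset.sum_congr rfl fun T hT => ?_
    rw [Finset.prod_ite_mem, Finset.inter_eq_right.2 (Finset.mem_powerset.1 hT), Finset.prod_const,
      ← Real.exp_nat_mul, mul_one]
  rw [h2, Finset.prod_const]
  -- Since e < 3, the left side is at most 1 + 2p.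
  have h3 : p * Real.exp 1 + (1 - p) * 1 ≤ Real.exp (2 * p) := by
    have := Real.exp_one_lt_d9
    have h4 := Real.add_one_le_exp (2 * p)
    nlinarith
  calc _ ≤ Real.exp (2 * p) ^ s.card := by
        refine pow_le_pow_left₀ ?_ h3 _
        have := Real.exp_pos 1
        have : 0 < 1 - p := by linarith
        positivity
    _ = _ := by rw [← Real.exp_nat_mul]; ring_nf

/-- A convex set is no more likely than its least costly point: the cost of the conditional mean
bounds the probability. -/
theorem exists_mem_Pr_le_exp_neg {p : ℝ} (hp0 : 0 < p) (hp1 : p < 1) (s : Finset ι)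
    {K : Set (ι → ℝ)} (hK : Convex ℝ K) (hne : ∃ T ⊆ s, ind T ∈ K) :
    ∃ x ∈ K, (∀ i, x i ∈ Set.Icc (0 : ℝ) 1) ∧
      Pr p s (fun T => ind T ∈ K) ≤ Real.exp (-∑ i ∈ s, relEnt p (x i)) := by
  classical
  have hq : 0 < 1 - p := by linarith
  set F := s.powerset.filter (fun T => ind T ∈ K) with hF
  have hFs : ∀ T ∈ F, T ⊆ s := fun T hT => Finset.mem_powerset.1 (Finset.mem_filter.1 hT).1
  set P := ∑ T ∈ F, wt p s T with hP
  have hPr : Pr p s (fun T => ind T ∈ K) = P := by unfold Pr; rw [hP, hF]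
  have hw : ∀ T ∈ F, 0 ≤ wt p s T := fun T _ => wt_nonneg hp0 hp1 s T
  have hP0 : 0 < P := by
    obtain ⟨T, hT, hTK⟩ := hne
    exact Finset.sum_pos (fun T _ => wt_pos hp0 hp1 s T) ⟨T, by simp [hF, hT, hTK]⟩
  -- `x` is the conditional mean of `ind T` given `ind T ∈ K`; convexity keeps it in `K`.
  set x : ι → ℝ := F.centerMass (wt p s) ind with hx
  have hxK : x ∈ K := hK.centerMass_mem hw hP0 fun T hT => (Finset.mem_filter.1 hT).2
  have hxi : ∀ i, P * x i = ∑ T ∈ F, wt p s T * ind T i := by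
    intro i
    rw [hx, Finset.centerMass, Pi.smul_apply, Finset.sum_apply, smul_eq_mul, ← hP, ← mul_assoc,
      mul_inv_cancel₀ hP0.ne', one_mul]
    simp
  have hxi' : ∀ i, P * (1 - x i) = ∑ T ∈ F, wt p s T * (1 - ind T i) := by
    intro i
    rw [mul_sub, hxi, hP, mul_one, ← Finset.sum_sub_distrib]
    simp [mul_sub]
  have hind : ∀ (T : Finset ι) i, 0 ≤ ind T i ∧ 0 ≤ 1 - ind T i := by
    intro T i; unfold ind; split_ifs <;> simp
  have hx0 : ∀ i, 0 ≤ x i := fun i => by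
    have : 0 ≤ P * x i := by
      rw [hxi]; exact Finset.sum_nonneg fun T hT => mul_nonneg (hw T hT) (hind T i).1
    exact nonneg_of_mul_nonneg_right this hP0
  have hx1 : ∀ i, 0 ≤ 1 - x i := fun i => by
    have : 0 ≤ P * (1 - x i) := by
      rw [hxi']; exact Finset.sum_nonneg fun T hT => mul_nonneg (hw T hT) (hind T i).2
    exact nonneg_of_mul_nonneg_right this hP0
  -- A coordinate with `x i` equal to 0 or 1 is constant over `F`, so the logarithms below that
  -- carry nonzero weight have positive arguments.
  have hxpos : ∀ T ∈ F, ∀ i ∈ T, 0 < x i := by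
    intro T hT i hi
    have : 0 < P * x i := by
      rw [hxi]
      refine Finset.sum_pos' (fun T hT => mul_nonneg (hw T hT) (hind T i).1) ⟨T, hT, ?_⟩
      simpa [ind, hi] using wt_pos hp0 hp1 s T
    exact pos_of_mul_pos_right this hP0.le
  have hxlt : ∀ T ∈ F, ∀ i ∉ T, 0 < 1 - x i := by
    intro T hT i hi
    have : 0 < P * (1 - x i) := by
      rw [hxi']
      refine Finset.sum_pos' (fun T hT => mul_nonneg (hw T hT) (hind T i).2) ⟨T, hT, ?_⟩
      simpa [ind, hi] using wt_pos hp0 hp1 s T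
    exact pos_of_mul_pos_right this hP0.le
  refine ⟨x, hxK, fun i => ⟨hx0 i, by linarith [hx1 i]⟩, ?_⟩
  rw [hPr]
  -- For `T ∈ F` this is the log-likelihood ratio at `T` of the product Bernoulli(`x i`) measure
  -- against Bernoulli(`p`). It is affine in `ind T`, so its conditional mean is its value at `x`,
  -- namely the relative entropy `m`.
  set f : Finset ι → ℝ := fun T => ∑ i ∈ s, (ind T i * Real.log (x i / p) +
    (1 - ind T i) * Real.log ((1 - x i) / (1 - p))) with hf
  set m := ∑ i ∈ s, relEnt p (x i) with hm
  have hmean : ∑ T ∈ F, wt p s T * f T = P * m := by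
    simp only [hf, Finset.mul_sum, hm]
    rw [Finset.sum_comm]
    refine Finset.sum_congr rfl fun i _ => ?_
    rw [relEnt, mul_add, ← mul_assoc, ← mul_assoc, hxi, hxi', Finset.sum_mul, Finset.sum_mul,
      ← Finset.sum_add_distrib]
    exact Finset.sum_congr rfl fun T _ => by ring
  have hQ : ∀ T ∈ F, wt p s T * Real.exp (f T) = ∏ i ∈ s, (if i ∈ T then x i else 1 - x i) := by
    intro T hT
    rw [wt_eq_prod p (hFs T hT), hf, Real.exp_sum, ← Finset.prod_mul_distrib]
    refine Finset.prod_congr rfl fun i _ => ?_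
    by_cases hi : i ∈ T
    · have := hxpos T hT i hi
      simp only [hi, if_true, ind, one_mul, sub_self, zero_mul, add_zero]
      rw [Real.exp_log (by positivity)]
      field_simp
    · have := hxlt T hT i hi
      simp only [hi, if_false, ind, zero_mul, sub_zero, one_mul, zero_add]
      rw [Real.exp_log (by positivity)]
      field_simp
  -- The left side is the mass of `F` under the product Bernoulli(`x i`) measure.
  have htot : ∑ T ∈ F, wt p s T * Real.exp (f T) ≤ 1 := by
    have h1 : ∑ T ∈ s.powerset, ∏ i ∈ s, (if i ∈ T then x i else 1 - x i) = 1 := by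
      have := (Finset.prod_add x (fun i => 1 - x i) s)
      simp only [add_sub_cancel, Finset.prod_const_one] at this
      refine Eq.trans ?_ this.symm
      refine Finset.sum_congr rfl fun T hT => ?_
      rw [Finset.mem_powerset] at hT
      rw [← Finset.prod_sdiff hT, mul_comm]
      congr 1
      · exact Finset.prod_congr rfl fun i hi => by simp [hi]
      · exact Finset.prod_congr rfl fun i hi => by simp [(Finset.mem_sdiff.1 hi).2]
    rw [Finset.sum_congr rfl hQ]
    refine le_trans ?_ h1.le
    refine Finset.sum_le_sum_of_subset_of_nonneg (Finset.filter_subset _ _) fun T _ _ => ?_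
    exact Finset.prod_nonneg fun i _ => by split_ifs; exacts [hx0 i, hx1 i]
  -- Jensen's inequality for `exp`, by the tangent line at `m`.
  have hjen : P * Real.exp m ≤ ∑ T ∈ F, wt p s T * Real.exp (f T) := by
    have h1 : ∀ T ∈ F, wt p s T * (Real.exp m * (f T - m + 1)) ≤ wt p s T * Real.exp (f T) := by
      intro T hT
      refine mul_le_mul_of_nonneg_left ?_ (hw T hT)
      calc Real.exp m * (f T - m + 1) ≤ Real.exp m * Real.exp (f T - m) :=
            mul_le_mul_of_nonneg_left (Real.add_one_le_exp _) (Real.exp_pos m).le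
        _ = Real.exp (f T) := by rw [← Real.exp_add]; ring_nf
    refine le_trans (le_of_eq ?_) (Finset.sum_le_sum h1)
    have h2 : ∑ T ∈ F, wt p s T * (Real.exp m * (f T - m + 1)) =
        Real.exp m * (∑ T ∈ F, wt p s T * f T - m * P + P) := by
      rw [hP, Finset.mul_sum, ← Finset.sum_sub_distrib, ← Finset.sum_add_distrib, Finset.mul_sum]
      exact Finset.sum_congr rfl fun T _ => by ring
    rw [h2, hmean]; ring
  rw [Real.exp_neg, ← one_div, le_div_iff₀ (Real.exp_pos m)]
  exact hjen.trans htot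

end Cube

/-! ### Talagrand's convex distance inequality -/

/-- Choice of the mixing parameter in the induction for Talagrand's inequality. -/
theorem exists_mixing_parameter {u : ℝ} (hu : 0 ≤ u) :
    ∃ l ∈ Set.Icc (0 : ℝ) 1, Real.exp ((1 - l) * u + l ^ 2 / 8) ≤ 2 - Real.exp (-u) := by
  rcases le_total u (1 / 2) with h | h
  · refine ⟨2 * u, ⟨by linarith, by linarith⟩, ?_⟩
    have h1 : (1 - 2 * u) * u + (2 * u) ^ 2 / 8 = u - 3 / 2 * u ^ 2 := by ring
    rw [h1]
    have h2 : Real.exp (-u) ≤ 1 - u + u ^ 2 / 2 := by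
      have := Real.quadratic_le_exp_of_nonneg hu
      have h3 : Real.exp (-u) * Real.exp u = 1 := by rw [← Real.exp_add]; simp
      have h4 := Real.exp_pos (-u)
      nlinarith [mul_le_mul_of_nonneg_left this h4.le, sq_nonneg (u ^ 2), sq_nonneg u]
    have h3 : Real.exp (u - 3 / 2 * u ^ 2) ≤ 1 + u - u ^ 2 / 2 := by
      have h4 := Real.add_one_le_exp (-(u - 3 / 2 * u ^ 2))
      have h5 : Real.exp (-(u - 3 / 2 * u ^ 2)) * Real.exp (u - 3 / 2 * u ^ 2) = 1 := by
        rw [← Real.exp_add]; simp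
      have h6 := Real.exp_pos (u - 3 / 2 * u ^ 2)
      have h7 : (1 + u - u ^ 2 / 2) * (-(u - 3 / 2 * u ^ 2) + 1) ≥ 1 := by
        have : (1 + u - u ^ 2 / 2) * (-(u - 3 / 2 * u ^ 2) + 1) = 1 + u ^ 3 * (2 - 3 / 4 * u) := by
          ring
        rw [this]
        have : 0 ≤ u ^ 3 * (2 - 3 / 4 * u) := mul_nonneg (by positivity) (by linarith)
        linarith
      have h8 : 0 < -(u - 3 / 2 * u ^ 2) + 1 := by nlinarith
      have h9 : (-(u - 3 / 2 * u ^ 2) + 1) * Real.exp (u - 3 / 2 * u ^ 2) ≤ 1 := by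
        nlinarith [mul_le_mul_of_nonneg_right h4 h6.le]
      by_contra! hc
      nlinarith [mul_lt_mul_of_pos_left hc h8]
    linarith
  · refine ⟨1, ⟨by norm_num, le_rfl⟩, ?_⟩
    have h1 : (1 - 1) * u + (1 : ℝ) ^ 2 / 8 = 1 / 8 := by ring
    rw [h1]
    have h2 : Real.exp (-u) ≤ 2 / 3 := by
      have h3 := Real.add_one_le_exp (1 / 2 : ℝ)
      have h4 : Real.exp (-u) ≤ Real.exp (-(1 / 2)) := Real.exp_le_exp.2 (by linarith)
      have h5 : Real.exp (-(1 / 2) : ℝ) * Real.exp (1 / 2) = 1 := by rw [← Real.exp_add]; simp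
      nlinarith [Real.exp_pos (-(1 / 2) : ℝ)]
    have h3 : Real.exp (1 / 8) ≤ 8 / 7 := by
      have h3 := Real.add_one_le_exp (-(1 / 8) : ℝ)
      have h5 : Real.exp (-(1 / 8) : ℝ) * Real.exp (1 / 8) = 1 := by rw [← Real.exp_add]; simp
      nlinarith [Real.exp_pos (1 / 8 : ℝ)]
    linarith

/-- Interpolation between two exponential moment bounds `∑ w e^{D/8} ≤ 1/a`, `∑ w e^{D'/8} ≤ 1/b`
for `a ≤ b`. -/
theorem exists_mixed_exp_moment {κ : Type*} (F : Finset κ) (w D D' : κ → ℝ) (hw : ∀ k ∈ F, 0 ≤ w k)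
    {a b : ℝ} (ha : 0 < a) (hab : a ≤ b)
    (hD : ∑ k ∈ F, w k * Real.exp (D k / 8) ≤ 1 / a)
    (hD' : ∑ k ∈ F, w k * Real.exp (D' k / 8) ≤ 1 / b) :
    ∃ l ∈ Set.Icc (0 : ℝ) 1,
      ∑ k ∈ F, w k * Real.exp ((l ^ 2 + (1 - l) * D k + l * D' k) / 8) ≤ (2 - a / b) / b := by
  have hb : 0 < b := ha.trans_le hab
  have hu : 0 ≤ Real.log (b / a) := Real.log_nonneg (by rwa [le_div_iff₀ ha, one_mul])
  obtain ⟨l, hl, h⟩ := exists_mixing_parameter hu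
  refine ⟨l, hl, ?_⟩
  have hexp : Real.exp (-Real.log (b / a)) = a / b := by
    rw [Real.exp_neg, Real.exp_log (by positivity), inv_div]
  rw [hexp] at h
  -- Hölder's inequality in additive form: adding `log a` and `log b` normalizes both moments to at
  -- most 1, and convexity of `exp` interpolates between them.
  have h1 : ∑ k ∈ F, w k * Real.exp ((1 - l) * (D k / 8 + Real.log a) +
      l * (D' k / 8 + Real.log b)) ≤ 1 := by
    calc _ ≤ ∑ k ∈ F, w k * ((1 - l) * (a * Real.exp (D k / 8)) +
          l * (b * Real.exp (D' k / 8))) := by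
          refine Finset.sum_le_sum fun k hk => mul_le_mul_of_nonneg_left ?_ (hw k hk)
          have := convexOn_exp.2 (Set.mem_univ (D k / 8 + Real.log a))
            (Set.mem_univ (D' k / 8 + Real.log b)) (sub_nonneg.2 hl.2) hl.1 (by ring)
          simp only [smul_eq_mul] at this
          rw [Real.exp_add (D k / 8), Real.exp_add (D' k / 8), Real.exp_log ha,
            Real.exp_log hb] at this
          linarith
      _ = (1 - l) * (a * ∑ k ∈ F, w k * Real.exp (D k / 8)) +
          l * (b * ∑ k ∈ F, w k * Real.exp (D' k / 8)) := by
          simp only [Finset.mul_sum]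
          rw [← Finset.sum_add_distrib]
          exact Finset.sum_congr rfl fun k _ => by ring
      _ ≤ (1 - l) * 1 + l * 1 := by
          have h2 : a * ∑ k ∈ F, w k * Real.exp (D k / 8) ≤ 1 := by
            rw [le_div_iff₀ ha] at hD; linarith
          have h3 : b * ∑ k ∈ F, w k * Real.exp (D' k / 8) ≤ 1 := by
            rw [le_div_iff₀ hb] at hD'; linarith
          exact add_le_add (mul_le_mul_of_nonneg_left h2 (sub_nonneg.2 hl.2))
            (mul_le_mul_of_nonneg_left h3 hl.1)
      _ = 1 := by ring
  have h2 : ∑ k ∈ F, w k * Real.exp ((l ^ 2 + (1 - l) * D k + l * D' k) / 8) =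
      Real.exp ((1 - l) * Real.log (b / a) + l ^ 2 / 8) * (1 / b) *
      ∑ k ∈ F, w k * Real.exp ((1 - l) * (D k / 8 + Real.log a) +
      l * (D' k / 8 + Real.log b)) := by
    have hb' : 1 / b = Real.exp (-Real.log b) := by
      rw [Real.exp_neg, Real.exp_log hb, one_div]
    rw [Finset.mul_sum]
    refine Finset.sum_congr rfl fun k _ => ?_
    rw [hb', mul_left_comm, ← Real.exp_add, ← Real.exp_add, Real.log_div hb.ne' ha.ne']
    ring_nf
  rw [h2]
  calc _ ≤ Real.exp ((1 - l) * Real.log (b / a) + l ^ 2 / 8) * (1 / b) * 1 :=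
        mul_le_mul_of_nonneg_left h1 (by positivity)
    _ ≤ (2 - a / b) * (1 / b) := by
        rw [mul_one]; exact mul_le_mul_of_nonneg_right h (by positivity)
    _ = _ := by ring

theorem sq_mix_le {l : ℝ} (hl : l ∈ Set.Icc (0 : ℝ) 1) (x y z : ℝ) :
    (x - ((1 - l) * y + l * z)) ^ 2 ≤ (1 - l) * (x - y) ^ 2 + l * (x - z) ^ 2 := by
  have : (1 - l) * (x - y) ^ 2 + l * (x - z) ^ 2 - (x - ((1 - l) * y + l * z)) ^ 2 =
      l * (1 - l) * (y - z) ^ 2 := by ring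
  have h : 0 ≤ l * (1 - l) * (y - z) ^ 2 :=
    mul_nonneg (mul_nonneg hl.1 (sub_nonneg.2 hl.2)) (sq_nonneg _)
  linarith

/-- Convexity of the squared distance along a segment. In the induction, `y` and `z` are near points
of the two slices of the convex set. -/
theorem sum_sq_mix_le {ι : Type*} (s : Finset ι) {l : ℝ} (hl : l ∈ Set.Icc (0 : ℝ) 1) (x y z v : ι → ℝ)
    (hv : ∀ i ∈ s, v i = (1 - l) * y i + l * z i) {D D' : ℝ}
    (hD : ∑ i ∈ s, (x i - y i) ^ 2 ≤ D) (hD' : ∑ i ∈ s, (x i - z i) ^ 2 ≤ D') :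
    ∑ i ∈ s, (x i - v i) ^ 2 ≤ (1 - l) * D + l * D' := by
  calc _ ≤ ∑ i ∈ s, ((1 - l) * (x i - y i) ^ 2 + l * (x i - z i) ^ 2) :=
        Finset.sum_le_sum fun i hi => by rw [hv i hi]; exact sq_mix_le hl _ _ _
    _ = (1 - l) * ∑ i ∈ s, (x i - y i) ^ 2 + l * ∑ i ∈ s, (x i - z i) ^ 2 := by
        rw [Finset.sum_add_distrib, Finset.mul_sum, Finset.mul_sum]
    _ ≤ _ := add_le_add (mul_le_mul_of_nonneg_left hD (sub_nonneg.2 hl.2))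
        (mul_le_mul_of_nonneg_left hD' hl.1)

/-! ### Induction over coordinates for Talagrand's inequality -/

section Cube

variable {ι : Type*} [DecidableEq ι]

theorem wt_insert_of_notMem (p : ℝ) {s T : Finset ι} {a : ι} (ha : a ∉ s) (hT : T ⊆ s) :
    wt p (insert a s) T = (1 - p) * wt p s T := by
  have haT : a ∉ T := fun h => ha (hT h)
  have : insert a s \ T = insert a (s \ T) := Finset.insert_sdiff_of_notMem _ haT
  rw [wt, wt, this, Finset.card_insert_of_notMem (by simp [ha])]
  ring

theorem wt_insert_insert (p : ℝ) {s T : Finset ι} {a : ι} (ha : a ∉ s) (hT : T ⊆ s) :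
    wt p (insert a s) (insert a T) = p * wt p s T := by
  have haT : a ∉ T := fun h => ha (hT h)
  have : insert a s \ insert a T = s \ T := by
    ext i; simp only [Finset.mem_sdiff, Finset.mem_insert]
    constructor
    · rintro ⟨h | h, h'⟩ <;> tauto
    · rintro ⟨h, h'⟩
      exact ⟨Or.inr h, fun h'' => h''.elim (fun h3 => ha (h3 ▸ h)) h'⟩
  rw [wt, wt, this, Finset.card_insert_of_notMem haT]
  ring

theorem sum_wt_insert (p : ℝ) {s : Finset ι} {a : ι} (ha : a ∉ s) (f : Finset ι → ℝ) :
    ∑ T ∈ (insert a s).powerset, wt p (insert a s) T * f T =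
      (1 - p) * ∑ T ∈ s.powerset, wt p s T * f T +
        p * ∑ T ∈ s.powerset, wt p s T * f (insert a T) := by
  rw [Finset.sum_powerset_insert ha, Finset.mul_sum, Finset.mul_sum]
  congr 1
  · refine Finset.sum_congr rfl fun T hT => ?_
    rw [wt_insert_of_notMem p ha (Finset.mem_powerset.1 hT)]; ring
  · refine Finset.sum_congr rfl fun T hT => ?_
    rw [wt_insert_insert p ha (Finset.mem_powerset.1 hT)]; ring

theorem Pr_eq_sum (p : ℝ) (s : Finset ι) (Q : Finset ι → Prop) [DecidablePred Q] :
    Pr p s Q = ∑ T ∈ s.powerset, wt p s T * (if Q T then 1 else 0) := by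
  unfold Pr
  rw [Finset.sum_filter]
  refine Finset.sum_congr rfl fun T _ => ?_
  by_cases h : Q T <;> simp [h]

theorem Pr_insert (p : ℝ) {s : Finset ι} {a : ι} (ha : a ∉ s) (Q : Finset ι → Prop) :
    Pr p (insert a s) Q = (1 - p) * Pr p s Q + p * Pr p s (fun T => Q (insert a T)) := by
  classical
  rw [Pr_eq_sum, Pr_eq_sum, Pr_eq_sum, sum_wt_insert p ha]

theorem Pr_pos {p : ℝ} (hp0 : 0 < p) (hp1 : p < 1) {s : Finset ι} {Q : Finset ι → Prop}
    {T : Finset ι} (hT : T ⊆ s) (hQ : Q T) : 0 < Pr p s Q := by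
  classical
  exact Finset.sum_pos (fun T _ => wt_pos hp0 hp1 s T) ⟨T, by simp [hT, hQ]⟩

theorem exists_of_Pr_pos {p : ℝ} {s : Finset ι} {Q : Finset ι → Prop}
    (h : 0 < Pr p s Q) : ∃ T ⊆ s, Q T := by
  classical
  by_contra! hc
  have : Pr p s Q = 0 := by
    rw [Pr_eq_sum]
    exact Finset.sum_eq_zero fun T hT => by simp [hc T (Finset.mem_powerset.1 hT)]
  linarith

/-- **Talagrand's convex distance inequality** on the discrete cube. -/
theorem talagrand {p : ℝ} (hp0 : 0 < p) (hp1 : p < 1) (s : Finset ι) :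
    ∀ K : Set (ι → ℝ), Convex ℝ K → (∃ T ⊆ s, ind T ∈ K) →
      ∃ D : Finset ι → ℝ, (∀ T ⊆ s, ∃ y ∈ K, ∑ i ∈ s, (ind T i - y i) ^ 2 ≤ D T) ∧
        ∑ T ∈ s.powerset, wt p s T * Real.exp (D T / 8) ≤ 1 / Pr p s (fun T => ind T ∈ K) := by
  classical
  have hq : 0 < 1 - p := by linarith
  induction s using Finset.induction_on with
  | empty =>
    rintro K - ⟨T, hT, hTK⟩
    rw [Finset.subset_empty] at hT
    subst hT
    refine ⟨fun _ => 0, fun T _ => ⟨_, hTK, by simp⟩, ?_⟩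
    simp [Pr_eq_sum, hTK, wt]
  | insert a s ha ih =>
    intro K hK hne
    let e : ι → ℝ := Pi.single a 1
    have hind : ∀ T ⊆ s, ind (insert a T) = ind T + e := by
      intro T hT
      have haT : a ∉ T := fun h => ha (hT h)
      ext i
      by_cases hi : i = a
      · subst hi; simp [ind, e, haT]
      · simp [ind, e, hi]
    have hinda : ∀ T ⊆ s, ind T a = 0 := fun T hT => by
      have haT : a ∉ T := fun h => ha (hT h)
      simp [ind, haT]
    -- The slices of `K` over the two faces of coordinate `a`. The upper one is translated down, so
    -- both have zero `a`-coordinate and the induction hypothesis over `s` applies.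
    let K0 : Set (ι → ℝ) := K ∩ {x | x a = 0}
    let K1 : Set (ι → ℝ) := (fun x => x + e) ⁻¹' K ∩ {x | x a = 0}
    have hplane : Convex ℝ {x : ι → ℝ | x a = 0} := by
      intro x hx y hy c d _ _ _
      simp only [Set.mem_ofPred_eq] at hx hy ⊢
      simp [hx, hy]
    have hK0 : Convex ℝ K0 := hK.inter hplane
    have hK1 : Convex ℝ K1 := (hK.translate_preimage_left e).inter hplane
    have hmem0 : ∀ T ⊆ s, (ind T ∈ K0 ↔ ind T ∈ K) := fun T hT =>
      ⟨fun h => h.1, fun h => ⟨h, hinda T hT⟩⟩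
    have hmem1 : ∀ T ⊆ s, (ind T ∈ K1 ↔ ind (insert a T) ∈ K) := fun T hT => by
      rw [hind T hT]; exact ⟨fun h => h.1, fun h => ⟨h, hinda T hT⟩⟩
    set P0 := Pr p s (fun T => ind T ∈ K0) with hP0
    set P1 := Pr p s (fun T => ind T ∈ K1) with hP1
    have hP : Pr p (insert a s) (fun T => ind T ∈ K) = (1 - p) * P0 + p * P1 := by
      rw [Pr_insert p ha, hP0, hP1]
      congr 2
      · exact le_antisymm (Pr_mono hp0 hp1 fun T hT h => (hmem0 T hT).2 h)
          (Pr_mono hp0 hp1 fun T hT h => (hmem0 T hT).1 h)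
      · exact le_antisymm (Pr_mono hp0 hp1 fun T hT h => (hmem1 T hT).2 h)
          (Pr_mono hp0 hp1 fun T hT h => (hmem1 T hT).1 h)
    have hP0n : 0 ≤ P0 := Pr_nonneg hp0 hp1 _ _
    have hP1n : 0 ≤ P1 := Pr_nonneg hp0 hp1 _ _
    -- combining bounds for the two faces
    have final : ∀ (M : ℝ) (D0 D1 : Finset ι → ℝ), 0 < M → 0 < (1 - p) * P0 + p * P1 →
        (∀ T ⊆ s, ∃ y ∈ K, ∑ i ∈ insert a s, (ind T i - y i) ^ 2 ≤ D0 T) →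
        (∀ T ⊆ s, ∃ y ∈ K, ∑ i ∈ insert a s, (ind (insert a T) i - y i) ^ 2 ≤ D1 T) →
        ∑ T ∈ s.powerset, wt p s T * Real.exp (D0 T / 8) ≤ (2 - P0 / M) / M →
        ∑ T ∈ s.powerset, wt p s T * Real.exp (D1 T / 8) ≤ (2 - P1 / M) / M →
        ∃ D : Finset ι → ℝ,
          (∀ T ⊆ insert a s, ∃ y ∈ K, ∑ i ∈ insert a s, (ind T i - y i) ^ 2 ≤ D T) ∧
          ∑ T ∈ (insert a s).powerset, wt p (insert a s) T * Real.exp (D T / 8) ≤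
            1 / Pr p (insert a s) (fun T => ind T ∈ K) := by
      intro M D0 D1 hM hPpos h0 h1 hs0 hs1
      refine ⟨fun T => if a ∈ T then D1 (T.erase a) else D0 T, ?_, ?_⟩
      · intro T hT
        by_cases haT : a ∈ T
        · obtain ⟨y, hy, hy'⟩ := h1 (T.erase a) (by
            rw [← Finset.erase_insert ha]; exact Finset.erase_subset_erase a hT)
          rw [Finset.insert_erase haT] at hy'
          exact ⟨y, hy, by simpa [haT] using hy'⟩
        · obtain ⟨y, hy, hy'⟩ := h0 T ((Finset.subset_insert_iff_of_notMem haT).1 hT)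
          exact ⟨y, hy, by simpa [haT] using hy'⟩
      · rw [sum_wt_insert p ha, hP]
        have e0 : ∑ T ∈ s.powerset, wt p s T *
            Real.exp ((if a ∈ T then D1 (T.erase a) else D0 T) / 8) =
            ∑ T ∈ s.powerset, wt p s T * Real.exp (D0 T / 8) := by
          refine Finset.sum_congr rfl fun T hT => ?_
          have haT : a ∉ T := fun h => ha (Finset.mem_powerset.1 hT h)
          simp [haT]
        have e1 : ∑ T ∈ s.powerset, wt p s T *
            Real.exp ((if a ∈ insert a T then D1 ((insert a T).erase a) else D0 (insert a T)) / 8) =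
            ∑ T ∈ s.powerset, wt p s T * Real.exp (D1 T / 8) := by
          refine Finset.sum_congr rfl fun T hT => ?_
          have haT : a ∉ T := fun h => ha (Finset.mem_powerset.1 hT h)
          simp [haT]
        rw [e0, e1]
        set P := (1 - p) * P0 + p * P1 with hPdef
        calc _ ≤ (1 - p) * ((2 - P0 / M) / M) + p * ((2 - P1 / M) / M) :=
              add_le_add (mul_le_mul_of_nonneg_left hs0 hq.le)
                (mul_le_mul_of_nonneg_left hs1 hp0.le)
          _ = (2 * M - P) / M ^ 2 := by rw [hPdef]; field_simp; ring
          -- This is (M - P)² ≥ 0; `M` will be the larger of the two face probabilities.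
          _ ≤ 1 / P := by
              rw [div_le_div_iff₀ (by positivity) hPpos]
              nlinarith [sq_nonneg (M - P)]
    have hexp : Real.exp (1 / 8) ≤ 2 := by
      have h3 := Real.add_one_le_exp (-(1 / 8) : ℝ)
      have h5 : Real.exp (-(1 / 8) : ℝ) * Real.exp (1 / 8) = 1 := by rw [← Real.exp_add]; simp
      nlinarith [Real.exp_pos (1 / 8 : ℝ)]
    -- When one face contains no points of `K`, the points of the other face are used at the price
    -- of 1 in squared distance, a factor exp(1/8) ≤ 2.
    have shift : ∀ (D : Finset ι → ℝ) (M : ℝ), 0 < M →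
        ∑ T ∈ s.powerset, wt p s T * Real.exp (D T / 8) ≤ 1 / M →
        ∑ T ∈ s.powerset, wt p s T * Real.exp ((1 + D T) / 8) ≤ (2 - 0 / M) / M := by
      intro D M hM h
      have : ∑ T ∈ s.powerset, wt p s T * Real.exp ((1 + D T) / 8) =
          Real.exp (1 / 8) * ∑ T ∈ s.powerset, wt p s T * Real.exp (D T / 8) := by
        rw [Finset.mul_sum]
        refine Finset.sum_congr rfl fun T _ => ?_
        rw [add_div, Real.exp_add]; ring
      rw [this]
      calc _ ≤ 2 * (1 / M) := mul_le_mul hexp h (Finset.sum_nonneg fun T _ =>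
            mul_nonneg (wt_nonneg hp0 hp1 s T) (Real.exp_pos _).le) (by norm_num)
        _ = _ := by ring
    -- points of `K` near the lower face and near the upper face
    have near0 : ∀ l ∈ Set.Icc (0 : ℝ) 1, ∀ y0 ∈ K0, ∀ y1 ∈ K1, ∀ T ⊆ s, ∀ d0 d1 : ℝ,
        ∑ i ∈ s, (ind T i - y0 i) ^ 2 ≤ d0 → ∑ i ∈ s, (ind T i - y1 i) ^ 2 ≤ d1 →
        ∃ y ∈ K, ∑ i ∈ insert a s, (ind T i - y i) ^ 2 ≤ l ^ 2 + (1 - l) * d0 + l * d1 := by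
      intro l hl y0 hy0 y1 hy1 T hT d0 d1 h0 h1
      refine ⟨(1 - l) • y0 + l • (y1 + e), hK hy0.1 hy1.1 (sub_nonneg.2 hl.2) hl.1 (by ring), ?_⟩
      have e1 : y0 a = 0 := hy0.2
      have e2 : y1 a = 0 := hy1.2
      rw [Finset.sum_insert ha, add_assoc]
      refine add_le_add (le_of_eq ?_) (sum_sq_mix_le s hl (ind T) y0 y1 _ ?_ h0 h1)
      · simp [hinda T hT, e1, e2, e]
      · intro i hi
        have : i ≠ a := fun h => ha (h ▸ hi)
        simp [e, this]
    have near1 : ∀ l ∈ Set.Icc (0 : ℝ) 1, ∀ y1 ∈ K1, ∀ y0 ∈ K0, ∀ T ⊆ s, ∀ d1 d0 : ℝ,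
        ∑ i ∈ s, (ind T i - y1 i) ^ 2 ≤ d1 → ∑ i ∈ s, (ind T i - y0 i) ^ 2 ≤ d0 →
        ∃ y ∈ K, ∑ i ∈ insert a s, (ind (insert a T) i - y i) ^ 2 ≤
          l ^ 2 + (1 - l) * d1 + l * d0 := by
      intro l hl y1 hy1 y0 hy0 T hT d1 d0 h1 h0
      refine ⟨(1 - l) • (y1 + e) + l • y0, hK hy1.1 hy0.1 (sub_nonneg.2 hl.2) hl.1 (by ring), ?_⟩
      have e1 : y0 a = 0 := hy0.2
      have e2 : y1 a = 0 := hy1.2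
      rw [Finset.sum_insert ha, add_assoc]
      have h2 : ∀ i ∈ s, ind (insert a T) i = ind T i := fun i hi => by
        have : i ≠ a := fun h => ha (h ▸ hi)
        simp [hind T hT, e, this]
      rw [Finset.sum_congr rfl fun i hi => by rw [h2 i hi]]
      refine add_le_add (le_of_eq ?_) (sum_sq_mix_le s hl (ind T) y1 y0 _ ?_ h1 h0)
      · simp [hind T hT, hinda T hT, e1, e2, e]
      · intro i hi
        have : i ≠ a := fun h => ha (h ▸ hi)
        simp [e, this]
    have hne' : (∃ T ⊆ s, ind T ∈ K0) ∨ (∃ T ⊆ s, ind T ∈ K1) := by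
      obtain ⟨T, hT, hTK⟩ := hne
      by_cases haT : a ∈ T
      · right
        have h1 : T.erase a ⊆ s := by
          rw [← Finset.erase_insert ha]; exact Finset.erase_subset_erase a hT
        exact ⟨T.erase a, h1, (hmem1 _ h1).2 (by rwa [Finset.insert_erase haT])⟩
      · left
        have h1 := (Finset.subset_insert_iff_of_notMem haT).1 hT
        exact ⟨T, h1, (hmem0 _ h1).2 hTK⟩
    have zeroP : ∀ L : Set (ι → ℝ), (¬ ∃ T ⊆ s, ind T ∈ L) → Pr p s (fun T => ind T ∈ L) = 0 := by
      intro L hL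
      by_contra hc
      exact hL (exists_of_Pr_pos (lt_of_le_of_ne (Pr_nonneg hp0 hp1 _ _) (Ne.symm hc)))
    by_cases h0 : ∃ T ⊆ s, ind T ∈ K0
    · have hP0pos : 0 < P0 := by
        obtain ⟨T, hT, h⟩ := h0
        exact Pr_pos hp0 hp1 (Q := fun T => ind T ∈ K0) hT h
      have hPpos : 0 < (1 - p) * P0 + p * P1 := by positivity
      obtain ⟨D0, hD0, hS0⟩ := ih K0 hK0 h0
      by_cases h1 : ∃ T ⊆ s, ind T ∈ K1
      · have hP1pos : 0 < P1 := by
          obtain ⟨T, hT, h⟩ := h1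
          exact Pr_pos hp0 hp1 (Q := fun T => ind T ∈ K1) hT h
        obtain ⟨D1, hD1, hS1⟩ := ih K1 hK1 h1
        choose! y0 hy0 hy0' using hD0
        choose! y1 hy1 hy1' using hD1
        have main : ∀ l0 ∈ Set.Icc (0 : ℝ) 1, ∀ l1 ∈ Set.Icc (0 : ℝ) 1, ∀ M : ℝ, 0 < M →
            ∑ T ∈ s.powerset, wt p s T * Real.exp ((l0 ^ 2 + (1 - l0) * D0 T + l0 * D1 T) / 8) ≤
              (2 - P0 / M) / M →
            ∑ T ∈ s.powerset, wt p s T * Real.exp ((l1 ^ 2 + (1 - l1) * D1 T + l1 * D0 T) / 8) ≤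
              (2 - P1 / M) / M → _ := fun l0 hl0 l1 hl1 M hM hs0 hs1 =>
          final M (fun T => l0 ^ 2 + (1 - l0) * D0 T + l0 * D1 T)
            (fun T => l1 ^ 2 + (1 - l1) * D1 T + l1 * D0 T) hM hPpos
            (fun T hT => near0 l0 hl0 _ (hy0 T hT) _ (hy1 T hT) T hT _ _ (hy0' T hT) (hy1' T hT))
            (fun T hT => near1 l1 hl1 _ (hy1 T hT) _ (hy0 T hT) T hT _ _ (hy1' T hT) (hy0' T hT))
            hs0 hs1
        have self : ∀ (D D' : Finset ι → ℝ) (P : ℝ), 0 < P →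
            ∑ T ∈ s.powerset, wt p s T * Real.exp (D T / 8) ≤ 1 / P →
            ∑ T ∈ s.powerset, wt p s T *
              Real.exp (((0 : ℝ) ^ 2 + (1 - 0) * D T + 0 * D' T) / 8) ≤ (2 - P / P) / P := by
          intro D D' P hP h
          rw [div_self hP.ne']
          norm_num
          simpa using h
        -- The face of larger probability uses its own points (mixing parameter 0); the other mixes
        -- in points of the larger one, with the parameter optimized.
        rcases le_total P0 P1 with hle | hle
        · obtain ⟨l, hl, h⟩ := exists_mixed_exp_moment s.powerset (wt p s) D0 D1
            (fun T _ => wt_nonneg hp0 hp1 s T) hP0pos hle hS0 hS1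
          exact main l hl 0 (by simp) P1 hP1pos h (self D1 D0 P1 hP1pos hS1)
        · obtain ⟨l, hl, h⟩ := exists_mixed_exp_moment s.powerset (wt p s) D1 D0
            (fun T _ => wt_nonneg hp0 hp1 s T) hP1pos hle hS1 hS0
          exact main 0 (by simp) l hl P0 hP0pos (self D0 D1 P0 hP0pos hS0) h
      · have hP1z : P1 = 0 := zeroP K1 h1
        refine final P0 D0 (fun T => 1 + D0 T) hP0pos hPpos ?_ ?_ ?_ ?_
        · intro T hT
          obtain ⟨y, hy, hy'⟩ := hD0 T hT
          refine ⟨y, hy.1, ?_⟩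
          have e1 : y a = 0 := hy.2
          rw [Finset.sum_insert ha, hinda T hT, e1]; simpa using hy'
        · intro T hT
          obtain ⟨y, hy, hy'⟩ := hD0 T hT
          refine ⟨y, hy.1, ?_⟩
          have e1 : y a = 0 := hy.2
          rw [Finset.sum_insert ha, e1]
          refine add_le_add (by simp [ind]) (le_trans (le_of_eq ?_) hy')
          refine Finset.sum_congr rfl fun i hi => ?_
          have : i ≠ a := fun h => ha (h ▸ hi)
          simp [hind T hT, e, this]
        · rw [div_self hP0pos.ne']; norm_num; simpa using hS0
        · rw [hP1z]; exact shift D0 P0 hP0pos hS0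
    · have h1 : ∃ T ⊆ s, ind T ∈ K1 := hne'.resolve_left h0
      have hP1pos : 0 < P1 := by
        obtain ⟨T, hT, h⟩ := h1
        exact Pr_pos hp0 hp1 (Q := fun T => ind T ∈ K1) hT h
      have hPpos : 0 < (1 - p) * P0 + p * P1 := by positivity
      have hP0z : P0 = 0 := zeroP K0 h0
      obtain ⟨D1, hD1, hS1⟩ := ih K1 hK1 h1
      refine final P1 (fun T => 1 + D1 T) D1 hP1pos hPpos ?_ ?_ ?_ ?_
      · intro T hT
        obtain ⟨y, hy, hy'⟩ := hD1 T hT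
        refine ⟨y + e, hy.1, ?_⟩
        have e1 : y a = 0 := hy.2
        rw [Finset.sum_insert ha]
        refine add_le_add (by simp [hinda T hT, e1, e]) (le_trans (le_of_eq ?_) hy')
        refine Finset.sum_congr rfl fun i hi => ?_
        have : i ≠ a := fun h => ha (h ▸ hi)
        simp [e, this]
      · intro T hT
        obtain ⟨y, hy, hy'⟩ := hD1 T hT
        refine ⟨y + e, hy.1, ?_⟩
        have e1 : y a = 0 := hy.2
        rw [Finset.sum_insert ha, hind T hT]
        refine le_trans (le_of_eq ?_) hy'
        simp [hinda T hT, e1]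
      · rw [hP0z]; exact shift D1 P1 hP1pos hS1
      · rw [div_self hP1pos.ne']; norm_num; simpa using hS1

/-- A convex set of probability at least `1/2` is within Euclidean distance `√u` of all but an
exponentially small proportion of the cube. -/
theorem Pr_far_from_convex_le {p : ℝ} (hp0 : 0 < p) (hp1 : p < 1) (s : Finset ι)
    {K : Set (ι → ℝ)} (hK : Convex ℝ K) (hhalf : 1 / 2 ≤ Pr p s (fun T => ind T ∈ K)) (u : ℝ) :
    Pr p s (fun T => ¬ ∃ y ∈ K, ∑ i ∈ s, (ind T i - y i) ^ 2 ≤ u) ≤ 2 * Real.exp (-(u / 8)) := by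
  obtain ⟨D, hD, hS⟩ := talagrand hp0 hp1 s K hK (exists_of_Pr_pos (by linarith))
  have h1 : Pr p s (fun T => ¬ ∃ y ∈ K, ∑ i ∈ s, (ind T i - y i) ^ 2 ≤ u) ≤
      Pr p s (fun T => Real.exp (u / 8) ≤ Real.exp (D T / 8)) := by
    refine Pr_mono hp0 hp1 fun T hT h => ?_
    obtain ⟨y, hy, hy'⟩ := hD T hT
    rw [Real.exp_le_exp]
    by_contra! hc
    exact h ⟨y, hy, by linarith⟩
  refine h1.trans ((Pr_le_of_markov hp0 hp1 s _ (fun T _ => (Real.exp_pos _).le)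
    (Real.exp_pos _)).trans ?_)
  rw [Real.exp_neg, ← div_eq_mul_inv]
  refine div_le_div_of_nonneg_right (hS.trans ?_) (Real.exp_pos _).le
  rw [div_le_iff₀ (by linarith)]
  linarith

/-! ### Mixed moments of centred Bernoulli variables -/

/-- Mixed moments of centred Bernoulli variables factorize over the distinct variables. -/
theorem sum_wt_prod_centred (p : ℝ) (s : Finset ι) {n : ℕ} (e : Fin n → ι) (he : ∀ t, e t ∈ s) :
    ∑ T ∈ s.powerset, wt p s T * ∏ t, (ind T (e t) - p) =
      ∏ i ∈ s, (p * (1 - p) ^ (Finset.univ.filter fun t => e t = i).card +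
        (1 - p) * (-p) ^ (Finset.univ.filter fun t => e t = i).card) := by
  rw [← sum_wt_mul_prod]
  refine Finset.sum_congr rfl fun T _ => ?_
  rw [← Finset.prod_fiberwise_of_maps_to (t := s) (g := e) (fun t _ => he t)]
  congr 1
  refine Finset.prod_congr rfl fun i _ => ?_
  rw [Finset.prod_congr rfl (g := fun _ => ind T i - p) (fun t ht => by
    rw [(Finset.mem_filter.1 ht).2]), Finset.prod_const]
  by_cases hi : i ∈ T <;> simp [ind, hi]

/-- A mixed moment of centred Bernoulli variables is at most `p ^ q`, where `q` is the number of
distinct variables. -/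
theorem sum_wt_prod_centred_le {p : ℝ} (hp0 : 0 < p) (hp1 : p < 1) (s : Finset ι) {n : ℕ}
    (e : Fin n → ι) (he : ∀ t, e t ∈ s) :
    ∑ T ∈ s.powerset, wt p s T * ∏ t, (ind T (e t) - p) ≤
      p ^ (Finset.univ.image e).card := by
  have hq : 0 < 1 - p := by linarith
  rw [sum_wt_prod_centred p s e he]
  let m : ι → ℕ := fun i => (Finset.univ.filter fun t => e t = i).card
  have himg : Finset.univ.image e ⊆ s := by
    intro i hi
    obtain ⟨t, -, rfl⟩ := Finset.mem_image.1 hi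
    exact he t
  refine (le_abs_self _).trans ?_
  rw [Finset.abs_prod, ← Finset.prod_const, ← Finset.prod_sdiff himg]
  have h2 : ∏ i ∈ s \ Finset.univ.image e, |p * (1 - p) ^ m i + (1 - p) * (-p) ^ m i| = 1 := by
    refine Finset.prod_eq_one fun i hi => ?_
    have : m i = 0 := by
      rw [Finset.card_eq_zero, Finset.filter_eq_empty_iff]
      intro t _ h
      exact (Finset.mem_sdiff.1 hi).2 (Finset.mem_image.2 ⟨t, Finset.mem_univ t, h⟩)
    simp [this]
  rw [h2, one_mul]
  refine Finset.prod_le_prod (fun i _ => abs_nonneg _) fun i hi => ?_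
  change |p * (1 - p) ^ m i + (1 - p) * (-p) ^ m i| ≤ p
  have hm : 1 ≤ m i := by
    obtain ⟨t, -, ht⟩ := Finset.mem_image.1 hi
    exact Finset.card_pos.2 ⟨t, by simp [ht]⟩
  obtain ⟨k, hk⟩ : ∃ k, m i = k + 1 := ⟨m i - 1, by omega⟩
  -- Multiplicity one gives the mean, which is 0; higher multiplicities give at most p(1-p) +
  -- (1-p)p² ≤ p.
  rcases Nat.eq_zero_or_pos k with h0 | h0
  · rw [hk, h0]
    have : p * (1 - p) ^ (0 + 1) + (1 - p) * (-p) ^ (0 + 1) = 0 := by ring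
    rw [this, abs_zero]; exact hp0.le
  · rw [hk]
    have h3 : (1 - p) ^ (k + 1) ≤ 1 - p := by
      calc (1 - p) ^ (k + 1) ≤ (1 - p) ^ 1 := pow_le_pow_of_le_one hq.le (by linarith) (by omega)
        _ = _ := pow_one _
    have h4 : p ^ (k + 1) ≤ p := by
      calc p ^ (k + 1) ≤ p ^ 1 := pow_le_pow_of_le_one hp0.le hp1.le (by omega)
        _ = _ := pow_one _
    calc _ ≤ |p * (1 - p) ^ (k + 1)| + |(1 - p) * (-p) ^ (k + 1)| := abs_add_le _ _
      _ = p * (1 - p) ^ (k + 1) + (1 - p) * p ^ (k + 1) := by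
          rw [abs_mul, abs_mul, abs_pow, abs_pow, abs_neg, abs_of_pos hp0, abs_of_pos hq]
      _ ≤ p * (1 - p) + (1 - p) * p ^ 2 := by
          have h5 : p ^ (k + 1) ≤ p ^ 2 := pow_le_pow_of_le_one hp0.le hp1.le (by omega)
          nlinarith
      _ ≤ p := by nlinarith

/-- A mixed moment of centred Bernoulli variables vanishes if some variable occurs only once. -/
theorem sum_wt_prod_centred_eq_zero {p : ℝ} (s : Finset ι) {n : ℕ}
    (e : Fin n → ι) (he : ∀ t, e t ∈ s) {t₀ : Fin n} (ht₀ : ∀ t, e t = e t₀ → t = t₀) :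
    ∑ T ∈ s.powerset, wt p s T * ∏ t, (ind T (e t) - p) = 0 := by
  rw [sum_wt_prod_centred p s e he]
  refine Finset.prod_eq_zero (he t₀) ?_
  have : (Finset.univ.filter fun t => e t = e t₀).card = 1 := by
    rw [Finset.card_eq_one]
    exact ⟨t₀, by ext t; simp only [Finset.mem_filter, Finset.mem_univ, true_and,
      Finset.mem_singleton]; exact ⟨ht₀ t, fun h => h ▸ rfl⟩⟩
  rw [this]; ring

end Cube

/-! ### Schatten norms of real symmetric matrices -/

section Schatten

open Matrix

/-- Jensen's inequality. The weights will be squared coordinates of a unit vector in an orthonormal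
basis. -/
theorem abs_weighted_sum_rpow_le {κ : Type*} (s : Finset κ) (w μ : κ → ℝ) {α : ℝ} (hα : 1 ≤ α)
    (hw : ∀ j ∈ s, 0 ≤ w j) (hw1 : ∑ j ∈ s, w j = 1) :
    |∑ j ∈ s, w j * μ j| ^ α ≤ ∑ j ∈ s, w j * |μ j| ^ α := by
  refine le_trans (Real.rpow_le_rpow (abs_nonneg _) ?_ (by linarith))
    (Real.rpow_arith_mean_le_arith_mean_rpow s w (fun j => |μ j|) hw hw1
      (fun j _ => abs_nonneg _) hα)
  refine (Finset.abs_sum_le_sum_abs _ _).trans (Finset.sum_le_sum fun j hj => ?_)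
  rw [abs_mul, abs_of_nonneg (hw j hj)]

variable {N : ℕ} {X Y U V : Matrix (Fin N) (Fin N) ℝ}

theorem exists_orthogonal_diagonalization (hX : X.IsHermitian) :
    ∃ V : Matrix (Fin N) (Fin N) ℝ, Vᵀ * V = 1 ∧ V * Vᵀ = 1 ∧
      X = V * diagonal hX.eigenvalues * Vᵀ := by
  refine ⟨hX.eigenvectorUnitary, ?_, ?_, ?_⟩
  · have := Unitary.coe_star_mul_self hX.eigenvectorUnitary
    rwa [star_eq_conjTranspose, conjTranspose_eq_transpose_of_trivial] at this
  · have := Unitary.coe_mul_star_self hX.eigenvectorUnitary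
    rwa [Unitary.coe_star, star_eq_conjTranspose, conjTranspose_eq_transpose_of_trivial] at this
  · conv_lhs => rw [hX.spectral_theorem]
    rw [Unitary.conjStarAlgAut_apply, star_eq_conjTranspose, conjTranspose_eq_transpose_of_trivial]
    rfl

theorem conj_diagonal_apply (W : Matrix (Fin N) (Fin N) ℝ) (μ : Fin N → ℝ) (i k : Fin N) :
    (W * diagonal μ * Wᵀ) i k = ∑ j, W i j * W k j * μ j := by
  rw [mul_apply]
  refine Finset.sum_congr rfl fun j _ => ?_
  rw [mul_diagonal, transpose_apply]; ring

theorem sum_row_sq (hV : V * Vᵀ = 1) (i : Fin N) : ∑ j, V i j ^ 2 = 1 := by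
  have := congrFun (congrFun hV i) i
  rw [mul_apply, one_apply_eq] at this
  rw [← this]
  exact Finset.sum_congr rfl fun j _ => by rw [transpose_apply]; ring

theorem sum_col_sq (hV : Vᵀ * V = 1) (j : Fin N) : ∑ i, V i j ^ 2 = 1 := by
  have := congrFun (congrFun hV j) j
  rw [mul_apply, one_apply_eq] at this
  rw [← this]
  exact Finset.sum_congr rfl fun j _ => by rw [transpose_apply]; ring

/-- The diagonal of a symmetric matrix in any orthonormal basis is dominated by its spectrum. -/
theorem sum_abs_diag_rpow_le {α : ℝ} (hα : 1 ≤ α) (μ : Fin N → ℝ) (hU : Uᵀ * U = 1)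
    (hU' : U * Uᵀ = 1) (hV : Vᵀ * V = 1) (hV' : V * Vᵀ = 1) :
    ∑ i, |(Uᵀ * (V * diagonal μ * Vᵀ) * U) i i| ^ α ≤ ∑ j, |μ j| ^ α := by
  -- `W` is orthogonal, so its squared entries form a doubly stochastic matrix: row sums 1 allow
  -- Jensen, column sums 1 finish after exchanging the sums.
  set W := Uᵀ * V with hW
  have hWt : Wᵀ = Vᵀ * U := by rw [hW, transpose_mul, transpose_transpose]
  have h1 : Uᵀ * (V * diagonal μ * Vᵀ) * U = W * diagonal μ * Wᵀ := by
    rw [hWt, hW]; simp only [Matrix.mul_assoc]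
  have hr : W * Wᵀ = 1 := by
    rw [hWt, hW, Matrix.mul_assoc, ← Matrix.mul_assoc V, hV', Matrix.one_mul, hU]
  have hc : Wᵀ * W = 1 := by
    rw [hWt, hW, Matrix.mul_assoc, ← Matrix.mul_assoc U, hU', Matrix.one_mul, hV]
  rw [h1]
  calc _ ≤ ∑ i, ∑ j, W i j ^ 2 * |μ j| ^ α := by
        refine Finset.sum_le_sum fun i _ => ?_
        rw [conj_diagonal_apply]
        have := abs_weighted_sum_rpow_le Finset.univ (fun j => W i j ^ 2) μ hα
          (fun j _ => sq_nonneg _) (sum_row_sq hr i)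
        simpa [sq] using this
    _ = ∑ j, |μ j| ^ α := by
        rw [Finset.sum_comm]
        refine Finset.sum_congr rfl fun j _ => ?_
        rw [← Finset.sum_mul, sum_col_sq hc, one_mul]

theorem diag_conj_eq_eigenvalues (hX : X.IsHermitian) (hV : Vᵀ * V = 1)
    (h : X = V * diagonal hX.eigenvalues * Vᵀ) (i : Fin N) :
    (Vᵀ * X * V) i i = hX.eigenvalues i := by
  have : Vᵀ * X * V = diagonal hX.eigenvalues := by
    conv_lhs => rw [h]
    rw [Matrix.mul_assoc, Matrix.mul_assoc, hV, Matrix.mul_one, ← Matrix.mul_assoc, hV,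
      Matrix.one_mul]
  rw [this, diagonal_apply_eq]

theorem sum_abs_rpow_nonneg {κ : Type*} (s : Finset κ) (μ : κ → ℝ) (α : ℝ) :
    0 ≤ ∑ j ∈ s, |μ j| ^ α :=
  Finset.sum_nonneg fun _ _ => Real.rpow_nonneg (abs_nonneg _) _

/-- The Schatten norm is computed, up to an inequality, by any orthogonal diagonalization. -/
theorem schattenNorm_le_of_eq_conj {α : ℝ} (hα : 1 ≤ α) (hX : X.IsHermitian) (μ : Fin N → ℝ)
    (hV : Vᵀ * V = 1) (hV' : V * Vᵀ = 1) (h : X = V * diagonal μ * Vᵀ) :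
    schattenNorm α hX ≤ (∑ j, |μ j| ^ α) ^ (1 / α) := by
  obtain ⟨U, hU, hU', hUX⟩ := exists_orthogonal_diagonalization hX
  refine Real.rpow_le_rpow (sum_abs_rpow_nonneg _ _ _) ?_ (by positivity)
  have := sum_abs_diag_rpow_le hα μ hU hU' hV hV'
  rw [← h] at this
  simpa only [diag_conj_eq_eigenvalues hX hU hUX] using this

/-- The triangle inequality for Schatten norms. -/
theorem schattenNorm_add_le {α : ℝ} (hα : 1 ≤ α) (hX : X.IsHermitian) (hY : Y.IsHermitian)
    (hXY : (X + Y).IsHermitian) :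
    schattenNorm α hXY ≤ schattenNorm α hX + schattenNorm α hY := by
  obtain ⟨U, hU, hU', hUXY⟩ := exists_orthogonal_diagonalization hXY
  obtain ⟨V, hV, hV', hVX⟩ := exists_orthogonal_diagonalization hX
  obtain ⟨W, hW, hW', hWY⟩ := exists_orthogonal_diagonalization hY
  -- In an eigenbasis of `X + Y` the norm is an ℓ^α norm of a sum of two diagonals. Minkowski
  -- separates them, and each diagonal is dominated by the spectrum of its matrix.
  have h1 : schattenNorm α hXY =
      (∑ i, |(Uᵀ * X * U) i i + (Uᵀ * Y * U) i i| ^ α) ^ (1 / α) := by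
    unfold schattenNorm
    congr 1
    refine Finset.sum_congr rfl fun i _ => ?_
    rw [← diag_conj_eq_eigenvalues hXY hU hUXY i, Matrix.mul_add, Matrix.add_mul, Matrix.add_apply]
  rw [h1]
  refine (Real.Lp_add_le _ _ _ hα).trans (add_le_add ?_ ?_)
  · refine Real.rpow_le_rpow (sum_abs_rpow_nonneg _ _ _) ?_ (by positivity)
    have := sum_abs_diag_rpow_le hα hX.eigenvalues hU hU' hV hV'
    rwa [← hVX] at this
  · refine Real.rpow_le_rpow (sum_abs_rpow_nonneg _ _ _) ?_ (by positivity)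
    have := sum_abs_diag_rpow_le hα hY.eigenvalues hU hU' hW hW'
    rwa [← hWY] at this

theorem schattenNorm_smul_le {α : ℝ} (hα : 1 ≤ α) (hX : X.IsHermitian) (c : ℝ)
    (hcX : (c • X).IsHermitian) : schattenNorm α hcX ≤ |c| * schattenNorm α hX := by
  obtain ⟨V, hV, hV', hVX⟩ := exists_orthogonal_diagonalization hX
  have h : c • X = V * diagonal (c • hX.eigenvalues) * Vᵀ := by
    conv_lhs => rw [hVX]
    rw [diagonal_smul, Matrix.mul_smul, Matrix.smul_mul]
  refine (schattenNorm_le_of_eq_conj hα hcX _ hV hV' h).trans (le_of_eq ?_)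
  have h2 : ∑ j, |(c • hX.eigenvalues) j| ^ α = |c| ^ α * ∑ j, |hX.eigenvalues j| ^ α := by
    rw [Finset.mul_sum]
    refine Finset.sum_congr rfl fun j _ => ?_
    rw [Pi.smul_apply, smul_eq_mul, abs_mul, Real.mul_rpow (abs_nonneg _) (abs_nonneg _)]
  rw [h2, Real.mul_rpow (Real.rpow_nonneg (abs_nonneg _) _) (sum_abs_rpow_nonneg _ _ _),
    ← Real.rpow_mul (abs_nonneg _), mul_one_div_cancel (by linarith), Real.rpow_one]
  rfl

theorem schattenNorm_congr (α : ℝ) (hX : X.IsHermitian) (hY : Y.IsHermitian) (h : X = Y) :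
    schattenNorm α hX = schattenNorm α hY := by
  subst h; rfl

theorem schattenNorm_sub_comm_le {α : ℝ} (hα : 1 ≤ α) (h1 : (X - Y).IsHermitian)
    (h2 : (Y - X).IsHermitian) : schattenNorm α h1 ≤ schattenNorm α h2 := by
  have h3 : ((-1 : ℝ) • (Y - X)).IsHermitian := by simpa using h1
  rw [schattenNorm_congr α h1 h3 (by simp)]
  simpa using schattenNorm_smul_le hα h2 (-1) h3

theorem pow_eq_conj_diagonal (hV : Vᵀ * V = 1) (hV' : V * Vᵀ = 1) (μ : Fin N → ℝ) (n : ℕ) :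
    (V * diagonal μ * Vᵀ) ^ n = V * diagonal (μ ^ n) * Vᵀ := by
  induction n with
  | zero => simp [hV']
  | succ n ih =>
    have h1 : diagonal (μ ^ (n + 1)) = diagonal (μ ^ n) * diagonal μ := by
      rw [diagonal_mul_diagonal, pow_succ]; rfl
    rw [pow_succ, ih, h1]
    calc V * diagonal (μ ^ n) * Vᵀ * (V * diagonal μ * Vᵀ)
        = V * diagonal (μ ^ n) * (Vᵀ * V) * diagonal μ * Vᵀ := by simp only [Matrix.mul_assoc]
      _ = _ := by rw [hV, Matrix.mul_one]; simp only [Matrix.mul_assoc]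

theorem trace_pow_eq_sum_eigenvalues_pow (hX : X.IsHermitian) (n : ℕ) :
    (X ^ n).trace = ∑ j, hX.eigenvalues j ^ n := by
  obtain ⟨V, hV, hV', hVX⟩ := exists_orthogonal_diagonalization hX
  conv_lhs => rw [hVX]
  rw [pow_eq_conj_diagonal hV hV', trace_mul_comm, ← Matrix.mul_assoc, hV, Matrix.one_mul,
    trace_diagonal]
  rfl

theorem sum_sq_entries_eq (hX : X.IsHermitian) :
    ∑ i, ∑ j, X i j ^ 2 = ∑ j, hX.eigenvalues j ^ 2 := by
  rw [← trace_pow_eq_sum_eigenvalues_pow, trace]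
  refine Finset.sum_congr rfl fun i _ => ?_
  rw [diag_apply, pow_two X, mul_apply]
  refine Finset.sum_congr rfl fun j _ => ?_
  have := hX.apply i j
  rw [star_trivial] at this
  rw [this, sq]

/-- |μ|^α = |μ|^(α-2) μ². This controls the part of the spectrum below a threshold `t`, and is where
α ≥ 2 enters. -/
theorem sum_rpow_le_of_sum_sq_le {κ : Type*} (s : Finset κ) (μ : κ → ℝ) {α t R : ℝ} (hα : 2 ≤ α)
    (ht : ∀ j ∈ s, |μ j| ≤ t) (hR : ∑ j ∈ s, μ j ^ 2 ≤ R) (ht0 : 0 ≤ t) :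
    ∑ j ∈ s, |μ j| ^ α ≤ t ^ (α - 2) * R := by
  calc ∑ j ∈ s, |μ j| ^ α ≤ ∑ j ∈ s, t ^ (α - 2) * μ j ^ 2 := by
        refine Finset.sum_le_sum fun j hj => ?_
        have h1 : |μ j| ^ α = |μ j| ^ (α - 2) * μ j ^ 2 := by
          rcases eq_or_ne (μ j) 0 with h | h
          · rw [h]; simp [show α ≠ 0 by linarith]
          · rw [← sq_abs (μ j), ← Real.rpow_natCast |μ j| 2, ← Real.rpow_add (abs_pos.2 h)]
            norm_num
        rw [h1]
        exact mul_le_mul_of_nonneg_right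
          (Real.rpow_le_rpow (abs_nonneg _) (ht j hj) (by linarith)) (sq_nonneg _)
    _ = t ^ (α - 2) * ∑ j ∈ s, μ j ^ 2 := by rw [Finset.mul_sum]
    _ ≤ _ := mul_le_mul_of_nonneg_left hR (Real.rpow_nonneg ht0 _)

/-- For `α ≥ 2` the Schatten norm is at most the Hilbert–Schmidt norm. -/
theorem schattenNorm_le_of_sum_sq_le {α : ℝ} (hα : 2 ≤ α) (hX : X.IsHermitian) {R : ℝ}
    (hR : 0 ≤ R) (h : ∑ i, ∑ j, X i j ^ 2 ≤ R ^ 2) : schattenNorm α hX ≤ R := by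
  rw [sum_sq_entries_eq hX] at h
  have h1 := sum_rpow_le_of_sum_sq_le Finset.univ hX.eigenvalues hα (t := R) (fun j _ => by
    refine abs_le_of_sq_le_sq ?_ hR
    exact (Finset.single_le_sum (f := fun j => hX.eigenvalues j ^ 2)
      (fun _ _ => sq_nonneg _) (Finset.mem_univ j)).trans h) h hR
  have h2 : R ^ (α - 2) * R ^ 2 = R ^ α := by
    rcases eq_or_lt_of_le hR with h | h
    · rw [← h]; simp [show α ≠ 0 by linarith]
    · rw [← Real.rpow_natCast R 2, ← Real.rpow_add h]; norm_num
  rw [h2] at h1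
  calc schattenNorm α hX ≤ (R ^ α) ^ (1 / α) :=
        Real.rpow_le_rpow (sum_abs_rpow_nonneg _ _ _) h1 (by positivity)
    _ = R := by rw [← Real.rpow_mul hR, mul_one_div_cancel (by linarith), Real.rpow_one]

/-- The Schatten norm dominates the quadratic form on unit vectors. -/
theorem abs_quadratic_le_schattenNorm {α : ℝ} (hα : 1 ≤ α) (hX : X.IsHermitian) (u : Fin N → ℝ)
    (hu : ∑ i, u i ^ 2 = 1) : |∑ i, ∑ k, u i * X i k * u k| ≤ schattenNorm α hX := by
  obtain ⟨V, hV, hV', hVX⟩ := exists_orthogonal_diagonalization hX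
  -- Coordinates of `u` in an eigenbasis: the quadratic form is an average of eigenvalues with
  -- weights `c j ^ 2`.
  set c : Fin N → ℝ := fun j => ∑ i, u i * V i j with hc
  have h1 : ∑ i, ∑ k, u i * X i k * u k = ∑ j, c j ^ 2 * hX.eigenvalues j := by
    have : ∀ i k, X i k = ∑ j, V i j * V k j * hX.eigenvalues j := fun i k => by
      conv_lhs => rw [hVX]
      exact conj_diagonal_apply V _ i k
    have hR : ∀ j, c j ^ 2 * hX.eigenvalues j =
        ∑ i, ∑ k, u i * (V i j * V k j * hX.eigenvalues j) * u k := fun j => by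
      rw [hc, sq, Finset.sum_mul_sum, Finset.sum_mul]
      refine Finset.sum_congr rfl fun i _ => ?_
      rw [Finset.sum_mul]
      exact Finset.sum_congr rfl fun k _ => by ring
    simp only [this, hR, Finset.mul_sum, Finset.sum_mul]
    rw [Finset.sum_congr rfl fun i _ => Finset.sum_comm, Finset.sum_comm]
  have h2 : ∑ j, c j ^ 2 = 1 := by
    have h3 : ∀ i k, ∑ j, V i j * V k j = if i = k then 1 else 0 := fun i k => by
      have := congrFun (congrFun hV' i) k
      rw [mul_apply, one_apply] at this
      simpa using this
    simp only [hc, sq, Finset.mul_sum, Finset.sum_mul]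
    rw [Finset.sum_comm]
    rw [Finset.sum_congr rfl fun k _ => Finset.sum_comm]
    rw [← hu]
    refine Finset.sum_congr rfl fun k _ => ?_
    have : ∀ i, ∑ j, u i * V i j * (u k * V k j) = u i * u k * (if i = k then 1 else 0) := by
      intro i
      rw [← h3, Finset.mul_sum]
      exact Finset.sum_congr rfl fun j _ => by ring
    simp only [this]
    simp [sq]
  have h3 := abs_weighted_sum_rpow_le Finset.univ (fun j => c j ^ 2) hX.eigenvalues hα
    (fun j _ => sq_nonneg _) h2
  have h4 : ∑ j, c j ^ 2 * |hX.eigenvalues j| ^ α ≤ ∑ j, |hX.eigenvalues j| ^ α := by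
    refine Finset.sum_le_sum fun j _ => ?_
    have : c j ^ 2 ≤ 1 := h2 ▸ Finset.single_le_sum (f := fun j => c j ^ 2)
      (fun _ _ => sq_nonneg _) (Finset.mem_univ j)
    exact mul_le_of_le_one_left (Real.rpow_nonneg (abs_nonneg _) _) this
  rw [h1]
  calc |∑ j, c j ^ 2 * hX.eigenvalues j|
      = (|∑ j, c j ^ 2 * hX.eigenvalues j| ^ α) ^ (1 / α) := by
        rw [← Real.rpow_mul (abs_nonneg _), mul_one_div_cancel (by linarith), Real.rpow_one]
    _ ≤ _ := Real.rpow_le_rpow (Real.rpow_nonneg (abs_nonneg _) _) (h3.trans h4) (by positivity)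

end Schatten

/-! ### A Schatten-norm net from low-rank matrices -/

section Net

open Matrix

/-- Index set of a net of symmetric `N × N` matrices of rank at most `k`. -/
abbrev NetIdx (N k : ℕ) : Type := (Fin k → Fin 3) × (Fin k → Fin N → Fin (2 * N ^ 5 + 1))

/-- The grid points in `[-N, N]` with spacing `N⁻⁴`. -/
noncomputable def gridVal (N : ℕ) (z : Fin (2 * N ^ 5 + 1)) : ℝ := (z : ℕ) / (N : ℝ) ^ 4 - N

/-- The matrices `∑ₐ ± wₐ wₐᵀ` with at most `k` summands and `wₐ` in the grid. -/
noncomputable def netMat {N k : ℕ} (z : NetIdx N k) : Matrix (Fin N) (Fin N) ℝ :=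
  fun i l => ∑ a, (((z.1 a : ℕ) : ℝ) - 1) * gridVal N (z.2 a i) * gridVal N (z.2 a l)

theorem isHermitian_netMat {N k : ℕ} (z : NetIdx N k) : (netMat z).IsHermitian := by
  ext i l
  simp only [conjTranspose_apply, netMat, star_trivial]
  exact Finset.sum_congr rfl fun a _ => by ring

theorem exists_gridVal_close {N : ℕ} (hN : 0 < N) {x : ℝ} (hx : |x| ≤ N) :
    ∃ z, |x - gridVal N z| ≤ 1 / (N : ℝ) ^ 4 := by
  have hN' : (0 : ℝ) < N := by exact_mod_cast hN
  obtain ⟨h1, h2⟩ := abs_le.1 hx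
  have h0 : 0 ≤ (x + N) * (N : ℝ) ^ 4 := mul_nonneg (by linarith) (by positivity)
  have hlt : ⌊(x + N) * (N : ℝ) ^ 4⌋₊ < 2 * N ^ 5 + 1 := by
    rw [Nat.lt_succ_iff]
    refine Nat.floor_le_of_le ?_
    push_cast
    calc (x + N) * (N : ℝ) ^ 4 ≤ (N + N) * (N : ℝ) ^ 4 := by gcongr
      _ = 2 * (N : ℝ) ^ 5 := by ring
  refine ⟨⟨_, hlt⟩, ?_⟩
  have h3 := Nat.floor_le h0
  have h4 := Nat.lt_floor_add_one ((x + N) * (N : ℝ) ^ 4)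
  simp only [gridVal]
  rw [abs_le]
  have h5 : (⌊(x + N) * (N : ℝ) ^ 4⌋₊ : ℝ) / (N : ℝ) ^ 4 ≤ x + N := by
    rwa [div_le_iff₀ (by positivity)]
  have h6 : x + N ≤ (⌊(x + N) * (N : ℝ) ^ 4⌋₊ : ℝ) / (N : ℝ) ^ 4 + 1 / (N : ℝ) ^ 4 := by
    rw [← add_div, le_div_iff₀ (by positivity)]; exact h4.le
  have h7 : 0 < 1 / (N : ℝ) ^ 4 := by positivity
  constructor <;> linarith

theorem abs_mul_sub_mul_le {x y a b M η : ℝ} (hx : |x| ≤ M) (hy : |y| ≤ M) (ha : |x - a| ≤ η)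
    (hb : |y - b| ≤ η) (hη : η ≤ M) : |x * y - a * b| ≤ 3 * M * η := by
  have hM : 0 ≤ M := (abs_nonneg x).trans hx
  have hη0 : 0 ≤ η := (abs_nonneg _).trans ha
  have h1 : x * y - a * b = x * (y - b) + y * (x - a) - (x - a) * (y - b) := by ring
  rw [h1]
  calc _ ≤ |x * (y - b)| + |y * (x - a)| + |(x - a) * (y - b)| :=
        (abs_sub _ _).trans (add_le_add_left (abs_add_le _ _) _)
    _ ≤ M * η + M * η + η * η := by
        rw [abs_mul, abs_mul, abs_mul]; gcongr
    _ ≤ _ := by nlinarith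

/-- Every symmetric matrix of bounded Hilbert–Schmidt norm is close, in Schatten norm, to an element
of the net. -/
theorem exists_netMat_close {N k : ℕ} (hN : 3 ≤ N) {α R τ : ℝ} (hα : 2 ≤ α) (hR : 0 ≤ R)
    (hRN : R ≤ (N : ℝ) ^ 2) (hτ : 0 < τ) (hk : ∀ n : ℕ, n * τ ^ 2 ≤ R ^ 2 → n ≤ k)
    {B : Matrix (Fin N) (Fin N) ℝ} (hB : B.IsHermitian) (hBR : ∑ i, ∑ j, B i j ^ 2 ≤ R ^ 2) :
    ∃ z : NetIdx N k, ∀ h : (B - netMat z).IsHermitian,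
      schattenNorm α h ≤ (τ ^ (α - 2) * R ^ 2) ^ (1 / α) + 1 := by
  classical
  have hN0 : 0 < N := by omega
  have hN3 : (3 : ℝ) ≤ N := by exact_mod_cast hN
  obtain ⟨V, hV, hV', hVB⟩ := exists_orthogonal_diagonalization hB
  set l := hB.eigenvalues with hl
  have hl2 : ∑ j, l j ^ 2 ≤ R ^ 2 := by rw [hl, ← sum_sq_entries_eq hB]; exact hBR
  have hlR : ∀ j, |l j| ≤ R := fun j => abs_le_of_sq_le_sq
    ((Finset.single_le_sum (f := fun j => l j ^ 2) (fun _ _ => sq_nonneg _)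
      (Finset.mem_univ j)).trans hl2) hR
  -- Only the eigenvalues above `τ` in modulus are discretized; the Hilbert–Schmidt bound allows at
  -- most `k` of them.
  set S := Finset.univ.filter fun j => τ < |l j| with hS
  have hcard : S.card ≤ k := by
    refine hk _ (le_trans ?_ hl2)
    calc (S.card : ℝ) * τ ^ 2 = ∑ j ∈ S, τ ^ 2 := by simp
      _ ≤ ∑ j ∈ S, l j ^ 2 := by
          refine Finset.sum_le_sum fun j hj => ?_
          rw [← sq_abs (l j)]
          exact pow_le_pow_left₀ hτ.le (Finset.mem_filter.1 hj).2.le 2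
      _ ≤ ∑ j, l j ^ 2 := Finset.sum_le_sum_of_subset_of_nonneg (Finset.subset_univ _)
          fun _ _ _ => sq_nonneg _
  obtain ⟨e⟩ : Nonempty (S ↪ Fin k) :=
    Function.Embedding.nonempty_of_card_le (by simpa using hcard)
  set w : Fin N → Fin N → ℝ := fun j i => Real.sqrt |l j| * V i j with hw
  have hV1 : ∀ i j, |V i j| ≤ 1 := fun i j => by
    refine abs_le_of_sq_le_sq ?_ zero_le_one
    rw [one_pow, ← sum_col_sq hV j]
    exact Finset.single_le_sum (f := fun i => V i j ^ 2) (fun _ _ => sq_nonneg _)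
      (Finset.mem_univ i)
  have hwN : ∀ j i, |w j i| ≤ N := fun j i => by
    rw [hw, abs_mul, abs_of_nonneg (Real.sqrt_nonneg _)]
    have h1 : Real.sqrt |l j| ≤ N := Real.sqrt_le_iff.2 ⟨by positivity, (hlR j).trans hRN⟩
    calc Real.sqrt |l j| * |V i j| ≤ N * 1 :=
          mul_le_mul h1 (hV1 i j) (abs_nonneg _) (by positivity)
      _ = N := mul_one _
  choose q hq using fun j i => exists_gridVal_close hN0 (hwN j i)
  -- The codes 0, 1, 2 stand for the signs -1, 0, 1.
  set sg : Fin N → Fin 3 := fun j => if 0 ≤ l j then 2 else 0 with hsg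
  have hsgv : ∀ j, (((sg j : ℕ) : ℝ) - 1) * |l j| = l j ∧ |((sg j : ℕ) : ℝ) - 1| = 1 := by
    intro j
    by_cases h : 0 ≤ l j
    · simp only [hsg, h, if_true, abs_of_nonneg]; norm_num
    · simp only [hsg, h, if_false, abs_of_neg (not_le.1 h)]; norm_num
  -- Unused slots get code 1, hence coefficient 0.
  let z : NetIdx N k := (Function.extend e (fun j : S => sg j) (fun _ => 1),
    Function.extend e (fun j : S => q j) (fun _ _ => 0))
  refine ⟨z, fun h => ?_⟩
  have hM : ∀ i m, netMat z i m = ∑ j ∈ S, (((sg j : ℕ) : ℝ) - 1) *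
      gridVal N (q j i) * gridVal N (q j m) := by
    intro i m
    rw [← Finset.sum_coe_sort S, netMat]
    symm
    refine Fintype.sum_of_injective e e.injective _ _ ?_ ?_
    · intro a ha
      have : z.1 a = 1 := Function.extend_apply' (fun j : S => sg j) (fun _ => 1) a ha
      rw [this]; norm_num
    · intro j
      have h1 : z.1 (e j) = sg j := e.injective.extend_apply (fun j : S => sg j) (fun _ => 1) j
      have h2 : z.2 (e j) = q j := e.injective.extend_apply (fun j : S => q j) (fun _ _ => 0) j
      rw [h1, h2]
  set μ : Fin N → ℝ := fun j => if j ∈ S then 0 else l j with hμ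
  set B₁ := V * diagonal μ * Vᵀ with hB₁
  have hB₁h : B₁.IsHermitian := by
    rw [IsHermitian, conjTranspose_eq_transpose_of_trivial, hB₁]
    simp [transpose_mul, Matrix.mul_assoc]
  have hB₂h : (B - netMat z - B₁).IsHermitian := h.sub hB₁h
  have hsum : B - netMat z = B₁ + (B - netMat z - B₁) := by abel
  have hsmall : schattenNorm α hB₁h ≤ (τ ^ (α - 2) * R ^ 2) ^ (1 / α) := by
    refine (schattenNorm_le_of_eq_conj (by linarith) hB₁h μ hV hV' hB₁).trans ?_
    refine Real.rpow_le_rpow (sum_abs_rpow_nonneg _ _ _) ?_ (by positivity)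
    refine sum_rpow_le_of_sum_sq_le _ _ hα ?_ ?_ hτ.le
    · intro j _
      simp only [hμ]
      split_ifs with hj
      · simpa using hτ.le
      · simpa [hS] using hj
    · refine le_trans (Finset.sum_le_sum fun j _ => ?_) hl2
      simp only [hμ]
      split_ifs
      · simpa using sq_nonneg _
      · exact le_rfl
  -- At most N rank-one terms, each with rounding error at most 3N · N⁻⁴. The resulting
  -- Hilbert–Schmidt error 3/N is at most 1 for N ≥ 3.
  have hentry : ∀ i m, |(B - netMat z - B₁) i m| ≤ 3 / (N : ℝ) ^ 2 := by
    intro i m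
    have h1 : (B - netMat z - B₁) i m = ∑ j ∈ S, (((sg j : ℕ) : ℝ) - 1) *
        (w j i * w j m - gridVal N (q j i) * gridVal N (q j m)) := by
      have h2 : B i m = ∑ j, V i j * V m j * l j := by
        conv_lhs => rw [hVB]
        exact conj_diagonal_apply V _ i m
      have h3 : B i m - B₁ i m = ∑ j ∈ S, (((sg j : ℕ) : ℝ) - 1) * (w j i * w j m) := by
        rw [h2, hB₁, conj_diagonal_apply, ← Finset.sum_sub_distrib]
        rw [← Finset.sum_subset (Finset.subset_univ S)]
        · refine Finset.sum_congr rfl fun j hj => ?_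
          have h4 : Real.sqrt |l j| * Real.sqrt |l j| = |l j| :=
            Real.mul_self_sqrt (abs_nonneg _)
          simp only [hμ, hj, if_true, hw]
          rw [mul_zero, sub_zero]
          conv_lhs => rw [← (hsgv j).1, ← h4]
          ring
        · intro j _ hj
          simp [hμ, hj]
      have h5 : (B - netMat z - B₁) i m = (B i m - B₁ i m) - netMat z i m := by
        simp only [Matrix.sub_apply]; ring
      rw [h5, h3, hM, ← Finset.sum_sub_distrib]
      exact Finset.sum_congr rfl fun j _ => by ring
    rw [h1]
    calc _ ≤ ∑ j ∈ S, 3 * (N : ℝ) * (1 / (N : ℝ) ^ 4) := by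
          refine (Finset.abs_sum_le_sum_abs _ _).trans (Finset.sum_le_sum fun j _ => ?_)
          rw [abs_mul, (hsgv j).2, one_mul]
          refine abs_mul_sub_mul_le (hwN j i) (hwN j m) (hq j i) (hq j m) ?_
          rw [div_le_iff₀ (by positivity)]
          have : (1 : ℝ) ≤ (N : ℝ) ^ 4 := one_le_pow₀ (by linarith)
          nlinarith
      _ = S.card * (3 * (N : ℝ) * (1 / (N : ℝ) ^ 4)) := by simp
      _ ≤ N * (3 * (N : ℝ) * (1 / (N : ℝ) ^ 4)) := by
          gcongr
          simpa using Finset.card_le_univ S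
      _ = 3 / (N : ℝ) ^ 2 := by field_simp
  have hbig : schattenNorm α hB₂h ≤ 1 := by
    refine schattenNorm_le_of_sum_sq_le hα hB₂h zero_le_one ?_
    calc _ ≤ ∑ _i : Fin N, ∑ _j : Fin N, (3 / (N : ℝ) ^ 2) ^ 2 := by
          refine Finset.sum_le_sum fun i _ => Finset.sum_le_sum fun m _ => ?_
          rw [← sq_abs]
          exact pow_le_pow_left₀ (abs_nonneg _) (hentry i m) 2
      _ = 9 / (N : ℝ) ^ 2 := by simp; field_simp; norm_num
      _ ≤ 1 ^ 2 := by
          rw [div_le_iff₀ (by positivity)]; nlinarith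
  have hadd := schattenNorm_add_le (by linarith : (1 : ℝ) ≤ α) hB₁h hB₂h (hB₁h.add hB₂h)
  rw [schattenNorm_congr α h (hB₁h.add hB₂h) hsum]
  linarith

/-- The net has at most `exp (14 k N log N)` elements. -/
theorem log_card_netIdx_le {N : ℕ} (k : ℕ) (hN : 3 ≤ N) :
    (Fintype.card (NetIdx N k) : ℝ) ≤ Real.exp (14 * k * N * Real.log N) := by
  have hN3 : (3 : ℝ) ≤ N := by exact_mod_cast hN
  have hN0 : (0 : ℝ) < N := by linarith
  have h1 : (Fintype.card (NetIdx N k) : ℝ) = 3 ^ k * ((2 * (N : ℝ) ^ 5 + 1) ^ N) ^ k := by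
    simp [NetIdx]
  have hlog : (N : ℝ) ^ 6 = Real.exp (6 * Real.log N) := by
    rw [← Real.rpow_natCast, Real.rpow_def_of_pos hN0]; ring_nf
  have h2 : 2 * (N : ℝ) ^ 5 + 1 ≤ (N : ℝ) ^ 6 := by
    have : (1 : ℝ) ≤ (N : ℝ) ^ 5 := one_le_pow₀ (by linarith)
    calc 2 * (N : ℝ) ^ 5 + 1 ≤ 3 * (N : ℝ) ^ 5 := by linarith
      _ ≤ N * (N : ℝ) ^ 5 := by gcongr
      _ = _ := by ring
  have h3 : (3 : ℝ) ≤ Real.exp (Real.log N) := by rwa [Real.exp_log hN0]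
  rw [h1]
  calc (3 : ℝ) ^ k * ((2 * (N : ℝ) ^ 5 + 1) ^ N) ^ k
      ≤ Real.exp (Real.log N) ^ k * ((Real.exp (6 * Real.log N)) ^ N) ^ k := by
        rw [← hlog]; gcongr
    _ = Real.exp ((k + 6 * k * N) * Real.log N) := by
        rw [← Real.exp_nat_mul, ← Real.exp_nat_mul, ← Real.exp_nat_mul, ← Real.exp_add]; ring_nf
    _ ≤ _ := by
        rw [Real.exp_le_exp]
        refine mul_le_mul_of_nonneg_right ?_ (Real.log_nonneg (by linarith))
        have : (0 : ℝ) ≤ k := by positivity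
        nlinarith

end Net

/-! ### Edge vectors, walks, and trace moments of the centred adjacency matrix -/

section Moments

open Matrix

/-- The symmetric matrix with zero diagonal whose entries are given by a function on pairs. -/
def toMat {N : ℕ} (x : Sym2 (Fin N) → ℝ) : Matrix (Fin N) (Fin N) ℝ :=
  fun i j => if i = j then 0 else x s(i, j)

/-- The edges of the complete graph. -/
def edges (N : ℕ) : Finset (Sym2 (Fin N)) := Finset.univ.filter fun e => ¬ e.IsDiag

variable {N : ℕ}

theorem isHermitian_toMat (x : Sym2 (Fin N) → ℝ) : (toMat x).IsHermitian := by
  ext i j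
  simp only [conjTranspose_apply, toMat, star_trivial]
  rw [Sym2.eq_swap]
  simp only [eq_comm]

theorem toMat_add (x y : Sym2 (Fin N) → ℝ) : toMat (x + y) = toMat x + toMat y := by
  ext i j; by_cases h : i = j <;> simp [toMat, h]

theorem toMat_sub (x y : Sym2 (Fin N) → ℝ) : toMat (x - y) = toMat x - toMat y := by
  ext i j; by_cases h : i = j <;> simp [toMat, h]

theorem toMat_smul (c : ℝ) (x : Sym2 (Fin N) → ℝ) : toMat (c • x) = c • toMat x := by
  ext i j; by_cases h : i = j <;> simp [toMat, h]

theorem toMat_mem_cX {x : Sym2 (Fin N) → ℝ} (hx : ∀ e, x e ∈ Set.Icc (0 : ℝ) 1) :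
    toMat x ∈ cX N := by
  refine ⟨?_, fun i => by simp [toMat], fun i j => ?_⟩
  · have := isHermitian_toMat x
    rwa [IsHermitian, conjTranspose_eq_transpose_of_trivial] at this
  · simp only [toMat]; split_ifs
    · simp
    · exact hx _

/-- Translates between the sum over i < j in the entropy and the unordered pairs that index the
cube. -/
theorem sum_Ioi_eq_sum_edges (g : Sym2 (Fin N) → ℝ) :
    ∑ i, ∑ j ∈ Finset.Ioi i, g s(i, j) = ∑ e ∈ edges N, g e := by
  have h := Finset.sum_sym2_filter_not_isDiag (Finset.univ : Finset (Fin N)) g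
  have h2 : (Finset.univ : Finset (Fin N)).sym2 = Finset.univ := by ext; simp
  rw [h2] at h
  rw [edges, h, Finset.sum_sigma']
  refine Finset.sum_bij (fun a _ => (a.1, a.2)) ?_ ?_ ?_ ?_
  · rintro ⟨i, j⟩ h; simp at h; simp [h, h.ne]
  · rintro ⟨i, j⟩ _ ⟨i', j'⟩ _ h; simp at h; simp [h]
  · rintro ⟨i, j⟩ h; simp at h; exact ⟨⟨i, j⟩, by simp [h], rfl⟩
  · intros; rfl

theorem matEnt_toMat (p : ℝ) (x : Sym2 (Fin N) → ℝ) :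
    matEnt p (toMat x) = ∑ e ∈ edges N, relEnt p (x e) := by
  rw [← sum_Ioi_eq_sum_edges, matEnt]
  refine Finset.sum_congr rfl fun i _ => Finset.sum_congr rfl fun j hj => ?_
  simp [toMat, (Finset.mem_Ioi.1 hj).ne]

theorem sum_sq_toMat (x : Sym2 (Fin N) → ℝ) :
    ∑ i, ∑ j, toMat x i j ^ 2 = 2 * ∑ e ∈ edges N, x e ^ 2 := by
  have h1 : ∀ i, ∑ j, toMat x i j ^ 2 =
      ∑ j ∈ Finset.Ioi i, x s(i, j) ^ 2 + ∑ j ∈ Finset.Iio i, x s(i, j) ^ 2 := by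
    intro i
    have h2 : (Finset.univ : Finset (Fin N)) = Finset.Ioi i ∪ (insert i (Finset.Iio i)) := by
      ext j; simp only [Finset.mem_univ, Finset.mem_union, Finset.mem_Ioi, Finset.mem_insert,
        Finset.mem_Iio, true_iff]
      rcases lt_trichotomy i j with h | h | h <;> simp [h]
    rw [h2, Finset.sum_union, Finset.sum_insert (by simp)]
    · have : toMat x i i = 0 := by simp [toMat]
      rw [this]
      simp only [ne_eq, OfNat.ofNat_ne_zero, not_false_eq_true, zero_pow, zero_add]
      congr 1
      · exact Finset.sum_congr rfl fun j hj => by simp [toMat, (Finset.mem_Ioi.1 hj).ne]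
      · exact Finset.sum_congr rfl fun j hj => by simp [toMat, (Finset.mem_Iio.1 hj).ne']
    · rw [Finset.disjoint_left]
      intro j hj hj'
      simp only [Finset.mem_Ioi, Finset.mem_insert, Finset.mem_Iio] at hj hj'
      rcases hj' with rfl | h
      · exact lt_irrefl _ hj
      · exact lt_asymm hj h
  simp only [h1]
  rw [Finset.sum_add_distrib, sum_Ioi_eq_sum_edges (fun e => x e ^ 2), two_mul]
  congr 1
  rw [← sum_Ioi_eq_sum_edges (fun e => x e ^ 2)]
  rw [Finset.sum_comm' (t' := Finset.univ) (s' := fun j => Finset.Ioi j) (by simp)]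
  refine Finset.sum_congr rfl fun i _ => Finset.sum_congr rfl fun j _ => ?_
  rw [Sym2.eq_swap]

theorem card_edges_le (N : ℕ) : ((edges N).card : ℝ) ≤ (N : ℝ) ^ 2 / 2 := by
  have h := sum_sq_toMat (N := N) (fun _ => 1)
  have h2 : ∑ i, ∑ j, toMat (N := N) (fun _ => 1) i j ^ 2 ≤ ∑ _i : Fin N, ∑ _j : Fin N, (1 : ℝ) := by
    refine Finset.sum_le_sum fun i _ => Finset.sum_le_sum fun j _ => ?_
    simp only [toMat]; split_ifs <;> simp
  rw [h] at h2
  simp at h2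
  linarith

/-- Entries of matrix powers as sums over walks. -/
theorem pow_apply_eq_sum_walks (B : Matrix (Fin N) (Fin N) ℝ) (n : ℕ) (i j : Fin N) :
    (B ^ n) i j = ∑ w : Fin (n + 1) → Fin N, if w 0 = i ∧ w (Fin.last n) = j then
      ∏ t : Fin n, B (w t.castSucc) (w t.succ) else 0 := by
  induction n generalizing i with
  | zero =>
    rw [pow_zero, one_apply]
    rw [← (Equiv.funUnique (Fin 1) (Fin N)).symm.sum_comp]
    by_cases h : i = j
    · subst h; simp
    · rw [if_neg h]; symm
      refine Finset.sum_eq_zero fun a _ => ?_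
      rw [if_neg]
      rintro ⟨h1, h2⟩
      apply h
      simp at h1 h2
      rw [← h1, ← h2]
  | succ n ih =>
    rw [pow_succ', mul_apply, ← (Fin.consEquiv (fun _ => Fin N)).sum_comp, Fintype.sum_prod_type]
    have h1 : ∀ a, ∑ w : Fin (n + 1) → Fin N,
        (if (Fin.consEquiv (fun _ => Fin N)) (a, w) 0 = i ∧
            (Fin.consEquiv (fun _ => Fin N)) (a, w) (Fin.last (n + 1)) = j then
          ∏ t : Fin (n + 1), B ((Fin.consEquiv (fun _ => Fin N)) (a, w) t.castSucc)
            ((Fin.consEquiv (fun _ => Fin N)) (a, w) t.succ) else 0) =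
        if a = i then ∑ w : Fin (n + 1) → Fin N, (if w (Fin.last n) = j then
          B i (w 0) * ∏ t : Fin n, B (w t.castSucc) (w t.succ) else 0) else 0 := by
      intro a
      by_cases ha : a = i
      · subst ha
        rw [if_pos rfl]
        refine Finset.sum_congr rfl fun w _ => ?_
        have hl : (Fin.consEquiv (fun _ => Fin N)) (a, w) (Fin.last (n + 1)) = w (Fin.last n) := by
          rw [← Fin.succ_last]; rfl
        have h0 : (Fin.consEquiv (fun _ => Fin N)) (a, w) 0 = a := rfl
        rw [hl, h0, Fin.prod_univ_succ]
        simp only [true_and]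
        rfl
      · rw [if_neg ha]
        refine Finset.sum_eq_zero fun w _ => ?_
        rw [if_neg]
        rintro ⟨h, -⟩
        exact ha h
    simp only [h1, Finset.sum_ite_eq', Finset.mem_univ, if_true]
    simp only [ih, Finset.mul_sum]
    rw [Finset.sum_comm]
    refine Finset.sum_congr rfl fun w _ => ?_
    by_cases hw : w (Fin.last n) = j
    · simp [hw]
    · simp [hw]

theorem trace_pow_eq_sum_walks (B : Matrix (Fin N) (Fin N) ℝ) (n : ℕ) :
    (B ^ n).trace = ∑ w : Fin (n + 1) → Fin N, if w (Fin.last n) = w 0 then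
      ∏ t : Fin n, B (w t.castSucc) (w t.succ) else 0 := by
  simp only [trace, diag_apply, pow_apply_eq_sum_walks]
  rw [Finset.sum_comm]
  refine Finset.sum_congr rfl fun w _ => ?_
  rw [Finset.sum_eq_single (w 0)]
  · simp
  · intro i _ hi
    rw [if_neg]
    rintro ⟨h, -⟩
    exact hi h.symm
  · simp

/-- A walk visits at most one vertex more than it has edges. -/
theorem card_vertices_le_card_edges_succ {V : Type*} [DecidableEq V] (w : ℕ → V) (n : ℕ) :
    ((Finset.range (n + 1)).image w).card ≤
      ((Finset.range n).image fun t => s(w t, w (t + 1))).card + 1 := by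
  induction n with
  | zero => simp
  | succ n ih =>
    have hI : (Finset.range (n + 1)).image (fun t => s(w t, w (t + 1))) =
        insert s(w n, w (n + 1)) ((Finset.range n).image fun t => s(w t, w (t + 1))) := by
      rw [Finset.range_add_one, Finset.image_insert]
    rw [Finset.range_add_one (n := n + 1), Finset.image_insert, hI]
    -- A step to a new vertex uses a new edge, since an old edge has both endpoints already visited.
    by_cases h : w (n + 1) ∈ (Finset.range (n + 1)).image w
    · rw [Finset.insert_eq_of_mem h]
      refine ih.trans (Nat.add_le_add_right (Finset.card_le_card (Finset.subset_insert _ _)) 1)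
    · rw [Finset.card_insert_of_notMem h, Finset.card_insert_of_notMem]
      · omega
      · intro h2
        obtain ⟨t, ht, h3⟩ := Finset.mem_image.1 h2
        apply h
        have h4 : w (n + 1) ∈ s(w t, w (t + 1)) := by rw [h3]; simp
        rw [Finset.mem_range] at ht
        rcases Sym2.mem_iff.1 h4 with h5 | h5
        · exact Finset.mem_image.2 ⟨t, by simp; omega, h5.symm⟩
        · exact Finset.mem_image.2 ⟨t + 1, by simp; omega, h5.symm⟩

theorem card_image_le_card_image_edges {V : Type*} [DecidableEq V] {n : ℕ} (w : Fin (n + 1) → V) :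
    (Finset.univ.image w).card ≤
      (Finset.univ.image fun t : Fin n => s(w t.castSucc, w t.succ)).card + 1 := by
  have h := card_vertices_le_card_edges_succ (fun t => w (Fin.ofNat (n + 1) t)) n
  refine le_trans (le_of_eq ?_) (h.trans (Nat.add_le_add_right (Finset.card_le_card ?_) 1))
  · congr 1
    ext v
    simp only [Finset.mem_image, Finset.mem_univ, true_and, Finset.mem_range]
    constructor
    · rintro ⟨t, rfl⟩
      exact ⟨t, t.2, by congr 1; ext; simp⟩
    · rintro ⟨t, _, rfl⟩
      exact ⟨_, rfl⟩
  · intro e he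
    obtain ⟨t, ht, rfl⟩ := Finset.mem_image.1 he
    rw [Finset.mem_range] at ht
    refine Finset.mem_image.2 ⟨⟨t, ht⟩, Finset.mem_univ _, ?_⟩
    have h1 : (⟨t, ht⟩ : Fin n).castSucc = Fin.ofNat (n + 1) t := by
      ext; simp [Nat.mod_eq_of_lt (show t < n + 1 by omega)]
    have h2 : (⟨t, ht⟩ : Fin n).succ = Fin.ofNat (n + 1) (t + 1) := by
      ext; simp [Nat.mod_eq_of_lt (show t + 1 < n + 1 by omega)]
    rw [h1, h2]

/-- Every nonempty fibre has at least two elements. -/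
theorem two_mul_card_image_le {κ : Type*} [DecidableEq κ] {n : ℕ} (e : Fin n → κ)
    (h : ∀ t₀, ∃ t, e t = e t₀ ∧ t ≠ t₀) : 2 * (Finset.univ.image e).card ≤ n := by
  have h1 := Finset.card_eq_sum_card_image e (Finset.univ : Finset (Fin n))
  rw [Finset.card_univ, Fintype.card_fin] at h1
  have h2 := Finset.card_nsmul_le_sum (Finset.univ.image e)
    (fun b => (Finset.univ.filter fun t => e t = b).card) 2 (by
      intro b hb
      obtain ⟨t₀, -, rfl⟩ := Finset.mem_image.1 hb
      obtain ⟨t, ht, hne⟩ := h t₀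
      exact Finset.one_lt_card.2 ⟨t, by simp [ht], t₀, by simp, hne⟩)
  rw [smul_eq_mul] at h2
  omega

/-- A map with `v` values factors through `Fin v`: choose labels for the values, then a map into
`Fin v`. -/
theorem card_filter_card_image_le (N n v : ℕ) :
    (Finset.univ.filter fun w : Fin n → Fin N => (Finset.univ.image w).card = v).card ≤
      N ^ v * v ^ n := by
  classical
  have h : (Finset.univ.filter fun w : Fin n → Fin N => (Finset.univ.image w).card = v) ⊆
      (Finset.univ : Finset ((Fin v → Fin N) × (Fin n → Fin v))).image fun a => a.1 ∘ a.2 := by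
    intro w hw
    have hv := (Finset.mem_filter.1 hw).2
    let E := Finset.equivFinOfCardEq hv
    refine Finset.mem_image.2 ⟨(fun a => (E.symm a : Fin N), fun t => E ⟨w t, by simp⟩),
      Finset.mem_univ _, ?_⟩
    ext t
    simp
  refine (Finset.card_le_card h).trans (Finset.card_image_le.trans ?_)
  simp

/-- The contribution of a single walk to the expected trace of a power of the centred adjacency
matrix. -/
theorem sum_wt_walk_le {p : ℝ} (hp0 : 0 < p) (hp1 : p < 1) (m : ℕ) (w : Fin (2 * m + 1) → Fin N) :
    ∑ T ∈ (edges N).powerset, wt p (edges N) T * (∏ t : Fin (2 * m),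
        toMat (fun e => ind T e - p) (w t.castSucc) (w t.succ)) ≤
      if (Finset.univ.image w).card ≤ m + 1 then p ^ ((Finset.univ.image w).card - 1) else 0 := by
  have hr : (0 : ℝ) ≤ if (Finset.univ.image w).card ≤ m + 1 then
      p ^ ((Finset.univ.image w).card - 1) else 0 := by split_ifs <;> positivity
  -- A walk that stays put at some step contributes 0, as the diagonal vanishes.
  by_cases hdiag : ∃ t : Fin (2 * m), w t.castSucc = w t.succ
  · obtain ⟨t, ht⟩ := hdiag
    refine le_trans (le_of_eq (Finset.sum_eq_zero fun T _ => ?_)) hr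
    rw [Finset.prod_eq_zero (Finset.mem_univ t) (by simp [toMat, ht]), mul_zero]
  · push Not at hdiag
    set e : Fin (2 * m) → Sym2 (Fin N) := fun t => s(w t.castSucc, w t.succ) with he
    have hes : ∀ t, e t ∈ edges N := fun t => by simp [edges, he, hdiag t]
    have h1 : ∀ T : Finset (Sym2 (Fin N)), ∏ t : Fin (2 * m),
        toMat (fun e => ind T e - p) (w t.castSucc) (w t.succ) = ∏ t, (ind T (e t) - p) := by
      intro T
      exact Finset.prod_congr rfl fun t _ => by simp [toMat, hdiag t, he]
    simp only [h1]
    -- If every edge is repeated, there are at most m distinct edges and hence at most m + 1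
    -- vertices; the number of vertices minus 1 bounds the number of edges from below. An edge used
    -- once makes the moment vanish.
    by_cases hrep : ∀ t₀, ∃ t, e t = e t₀ ∧ t ≠ t₀
    · have h2 := two_mul_card_image_le e hrep
      have h3 : _ ≤ (Finset.univ.image e).card + 1 := card_image_le_card_image_edges w
      rw [if_pos (by omega)]
      refine (sum_wt_prod_centred_le hp0 hp1 _ e hes).trans ?_
      exact pow_le_pow_of_le_one hp0.le hp1.le (by omega)
    · push Not at hrep
      obtain ⟨t₀, ht₀⟩ := hrep
      rw [sum_wt_prod_centred_eq_zero _ e hes ht₀]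
      exact hr

/-- The constant in the trace moment bound. -/
def momentConst (m : ℕ) : ℕ := ∑ v ∈ Finset.range (m + 2), v ^ (2 * m + 1)

/-- Trace moments of the centred adjacency matrix. -/
theorem sum_wt_trace_pow_le {p : ℝ} (hp0 : 0 < p) (hp1 : p < 1) (m : ℕ) (hNp : 1 ≤ N * p) :
    ∑ T ∈ (edges N).powerset, wt p (edges N) T *
        ((toMat (N := N) (fun e => ind T e - p)) ^ (2 * m)).trace ≤
      momentConst m * (N * (N * p) ^ m) := by
  have h1 : ∑ T ∈ (edges N).powerset, wt p (edges N) T *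
        ((toMat (N := N) (fun e => ind T e - p)) ^ (2 * m)).trace =
      ∑ w : Fin (2 * m + 1) → Fin N, if w (Fin.last (2 * m)) = w 0 then
        ∑ T ∈ (edges N).powerset, wt p (edges N) T * (∏ t : Fin (2 * m),
          toMat (fun e => ind T e - p) (w t.castSucc) (w t.succ)) else 0 := by
    simp only [trace_pow_eq_sum_walks, Finset.mul_sum]
    rw [Finset.sum_comm]
    refine Finset.sum_congr rfl fun w _ => ?_
    split_ifs
    · rfl
    · simp
  rw [h1]
  -- The condition that the walk is closed is dropped: grouping all walks by their number v of
  -- vertices already gives the order N^v p^(v-1) = N (Np)^(v-1).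
  calc _ ≤ ∑ w : Fin (2 * m + 1) → Fin N, (if (Finset.univ.image w).card ≤ m + 1 then
        p ^ ((Finset.univ.image w).card - 1) else 0) := by
        refine Finset.sum_le_sum fun w _ => ?_
        split_ifs with ha hb hb
        · simpa [hb] using sum_wt_walk_le hp0 hp1 m w
        · simpa [hb] using sum_wt_walk_le hp0 hp1 m w
        · positivity
        · exact le_rfl
    _ = ∑ v ∈ Finset.range (m + 2),
        ((Finset.univ.filter fun w : Fin (2 * m + 1) → Fin N =>
          (Finset.univ.image w).card = v).card : ℝ) * p ^ (v - 1) := by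
        rw [← Finset.sum_filter]
        rw [← Finset.sum_fiberwise_of_maps_to (t := Finset.range (m + 2))
          (g := fun w : Fin (2 * m + 1) → Fin N => (Finset.univ.image w).card) (by
            intro w hw; have := (Finset.mem_filter.1 hw).2; simp; omega)]
        refine Finset.sum_congr rfl fun v hv => ?_
        rw [Finset.mem_range] at hv
        rw [Finset.filter_filter, ← nsmul_eq_mul, ← Finset.sum_const]
        refine Finset.sum_congr ?_ fun w hw => by rw [(Finset.mem_filter.1 hw).2]
        ext w
        simp only [Finset.mem_filter, Finset.mem_univ, true_and]
        omega
    _ ≤ ∑ v ∈ Finset.range (m + 2), (v : ℝ) ^ (2 * m + 1) * (N * (N * p) ^ m) := by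
        refine Finset.sum_le_sum fun v hv => ?_
        rw [Finset.mem_range] at hv
        have h2 : ((Finset.univ.filter fun w : Fin (2 * m + 1) → Fin N =>
          (Finset.univ.image w).card = v).card : ℝ) ≤ (N : ℝ) ^ v * (v : ℝ) ^ (2 * m + 1) := by
          exact_mod_cast card_filter_card_image_le N (2 * m + 1) v
        rcases Nat.eq_zero_or_pos v with h0 | h0
        · subst h0
          exact (mul_le_mul_of_nonneg_right h2 (by positivity)).trans (by simp)
        · obtain ⟨k, rfl⟩ : ∃ k, v = k + 1 := ⟨v - 1, by omega⟩
          calc _ ≤ (N : ℝ) ^ (k + 1) * ((k + 1 : ℕ) : ℝ) ^ (2 * m + 1) * p ^ (k + 1 - 1) := by gcongr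
            _ = ((k + 1 : ℕ) : ℝ) ^ (2 * m + 1) * (N * (N * p) ^ k) := by
                rw [Nat.add_sub_cancel, mul_pow]; ring
            _ ≤ _ := by
                have : (N * p) ^ k ≤ (N * p) ^ m := pow_le_pow_right₀ hNp (by omega)
                gcongr
    _ = _ := by
        rw [momentConst, ← Finset.sum_mul]; push_cast; rfl

/-- With probability at least `1/2`, the Schatten norm of the centred adjacency matrix is
of order at most `N^{1/α} √(Np)`. -/
theorem half_le_Pr_schattenNorm_le {p : ℝ} (hp0 : 0 < p) (hp1 : p < 1) {α : ℝ} (hα : 1 ≤ α)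
    (m : ℕ) (hm : α ≤ 2 * m) (hNp : 1 ≤ N * p) :
    1 / 2 ≤ Pr p (edges N) (fun T => schattenNorm α
      (isHermitian_toMat (N := N) (fun e => ind T e - p)) ≤
        ((1 + 2 * momentConst m) * N * (N * p) ^ (α / 2)) ^ (1 / α)) := by
  have hN : 0 < N := by
    rcases Nat.eq_zero_or_pos N with h | h
    · subst h; norm_num at hNp
    · exact h
  have hNr : (0 : ℝ) < N := by exact_mod_cast hN
  have hm0 : 0 < m := by
    rcases Nat.eq_zero_or_pos m with h | h
    · subst h; norm_num at hm; linarith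
    · exact h
  set C := momentConst m with hC
  have hC1 : (1 : ℝ) ≤ C := by
    have h1 : 1 ^ (2 * m + 1) ≤ momentConst m :=
      Finset.single_le_sum (f := fun v => v ^ (2 * m + 1)) (fun _ _ => Nat.zero_le _)
        (Finset.mem_range.2 (show 1 < m + 2 by omega))
    rw [one_pow] at h1
    exact_mod_cast h1
  set f : Finset (Sym2 (Fin N)) → ℝ := fun T =>
    ((toMat (N := N) (fun e => ind T e - p)) ^ (2 * m)).trace with hf
  have hf0 : ∀ T ⊆ edges N, 0 ≤ f T := fun T _ => by
    rw [hf]; dsimp only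
    rw [trace_pow_eq_sum_eigenvalues_pow (isHermitian_toMat _)]
    exact Finset.sum_nonneg fun j _ => by rw [pow_mul]; positivity
  -- Twice the bound on the mean, so that Markov's inequality leaves probability 1/2.
  set c := 2 * (C * (N * (N * p) ^ m)) with hc
  have hc0 : 0 < c := by positivity
  have h1 := Pr_le_of_markov hp0 hp1 (edges N) f hf0 hc0
  have h2 : (∑ T ∈ (edges N).powerset, wt p (edges N) T * f T) / c ≤ 1 / 2 := by
    rw [div_le_iff₀ hc0, hc]
    have := sum_wt_trace_pow_le hp0 hp1 m hNp
    simp only [hf]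
    linarith
  have h3 := Pr_add_Pr_not p (edges N) (fun T => c ≤ f T)
  rw [sum_wt] at h3
  have h4 : 1 / 2 ≤ Pr p (edges N) (fun T => ¬ c ≤ f T) := by linarith
  refine h4.trans (Pr_mono hp0 hp1 fun T _ hT => ?_)
  push Not at hT
  refine Real.rpow_le_rpow (sum_abs_rpow_nonneg _ _ _) ?_ (by positivity)
  set l := (isHermitian_toMat (N := N) (fun e => ind T e - p)).eigenvalues with hl
  have h5 : ∑ j, l j ^ (2 * m) ≤ c := by
    rw [hl, ← trace_pow_eq_sum_eigenvalues_pow]; exact hT.le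
  set r := Real.sqrt (N * p) with hr
  have hr0 : 0 < r := Real.sqrt_pos.2 (by positivity)
  have hrα : r ^ α = (N * p) ^ (α / 2) := by
    rw [hr, Real.sqrt_eq_rpow, ← Real.rpow_mul (by positivity)]; ring_nf
  have hrm : r ^ (2 * m) = (N * p) ^ m := by
    rw [pow_mul, hr, Real.sq_sqrt (by positivity)]
  -- Passage from the even exponent 2m ≥ α to the real exponent α at the scale r = √(Np): x^α ≤ 1 +
  -- x^(2m) for x ≥ 0.
  have h6 : ∀ j, |l j| ^ α ≤ r ^ α * (1 + l j ^ (2 * m) / r ^ (2 * m)) := by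
    intro j
    have h7 : |l j| ^ α = r ^ α * (|l j| / r) ^ α := by
      rw [Real.div_rpow (abs_nonneg _) hr0.le]; field_simp
    have h8 : l j ^ (2 * m) / r ^ (2 * m) = (|l j| / r) ^ (2 * m) := by
      rw [div_pow, pow_mul |l j|, sq_abs, ← pow_mul]
    rw [h7, h8]
    refine mul_le_mul_of_nonneg_left ?_ (Real.rpow_nonneg hr0.le _)
    have h9 : 0 ≤ |l j| / r := by positivity
    have h10 : 0 ≤ (|l j| / r) ^ (2 * m) := by positivity
    rcases le_total (|l j| / r) 1 with h | h
    · have := Real.rpow_le_one h9 h (by linarith : 0 ≤ α)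
      linarith
    · have := Real.rpow_le_rpow_of_exponent_le h (show α ≤ ((2 * m : ℕ) : ℝ) by push_cast; exact hm)
      rw [Real.rpow_natCast] at this
      linarith
  calc ∑ j, |l j| ^ α ≤ ∑ j, r ^ α * (1 + l j ^ (2 * m) / r ^ (2 * m)) :=
        Finset.sum_le_sum fun j _ => h6 j
    _ = r ^ α * (N + (∑ j, l j ^ (2 * m)) / r ^ (2 * m)) := by
        rw [← Finset.mul_sum, Finset.sum_add_distrib, Finset.sum_div]; simp
    _ ≤ r ^ α * (N + c / r ^ (2 * m)) := by gcongr
    _ = _ := by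
        rw [hrm, hrα, hc]
        have : ((N : ℝ) * p) ^ m ≠ 0 := by positivity
        field_simp

end Moments

/-! ### Tail bounds by covering, for a fixed number of vertices -/

section Finite

open Matrix MeasureTheory unitInterval

variable {N : ℕ}

/-- The edge set of a graph, as a finite set. -/
noncomputable def edgeF (G : SimpleGraph (Fin N)) : Finset (Sym2 (Fin N)) :=
  (Set.toFinite G.edgeSet).toFinset

theorem edgeF_subset (G : SimpleGraph (Fin N)) : edgeF G ⊆ edges N := by
  intro e he
  simp only [edgeF, Set.Finite.mem_toFinset] at he
  simp only [edges, Finset.mem_filter, Finset.mem_univ, true_and]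
  exact G.not_isDiag_of_mem_edgeSet he

theorem edgeF_injective : Function.Injective (edgeF (N := N)) := by
  intro G H h
  apply SimpleGraph.edgeSet_injective
  simpa [edgeF] using h

theorem adj_eq_toMat (G : SimpleGraph (Fin N)) :
    (adj G : Matrix (Fin N) (Fin N) ℝ) = toMat (ind (edgeF G)) := by
  ext i j
  simp only [adj, SimpleGraph.adjMatrix_apply, toMat, ind, edgeF, Set.Finite.mem_toFinset,
    SimpleGraph.mem_edgeSet]
  by_cases h : i = j
  · subst h; simp
  · rw [if_neg h]
    classical
    refine if_congr ?_ rfl rfl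
    rw [Set.Finite.mem_toFinset, SimpleGraph.mem_edgeSet]

theorem card_edges (N : ℕ) : (edges N).card = N.choose 2 := by
  have := Sym2.card_diagSet_compl (α := Fin N)
  rw [Fintype.card_fin] at this
  rw [← this, edges, Fintype.card_subtype]
  exact congrArg _ (Finset.ext fun e => by simp)

theorem binomialRandom_le_Pr (p : I) (S : Set (SimpleGraph (Fin N)))
    (Q : Finset (Sym2 (Fin N)) → Prop) (hQ : ∀ G ∈ S, Q (edgeF G)) (hp0 : 0 < (p : ℝ))
    (hp1 : (p : ℝ) < 1) :
    SimpleGraph.binomialRandom (Fin N) p S ≤ ENNReal.ofReal (Pr p (edges N) Q) := by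
  classical
  have h1 : SimpleGraph.binomialRandom (Fin N) p S ≤
      ∑ G ∈ Finset.univ.filter (· ∈ S), SimpleGraph.binomialRandom (Fin N) p {G} := by
    refine le_trans (measure_mono ?_) (measure_biUnion_finset_le _ _)
    intro G hG
    simp [hG]
  have h2 : ∀ G : SimpleGraph (Fin N), SimpleGraph.binomialRandom (Fin N) p {G} =
      ENNReal.ofReal (wt p (edges N) (edgeF G)) := by
    intro G
    rw [SimpleGraph.binomialRandom_singleton, wt, Finset.card_sdiff_of_subset (edgeF_subset G),
      card_edges, Nat.card_eq_fintype_card, Fintype.card_fin,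
      Set.ncard_eq_toFinset_card _ (Set.toFinite G.edgeSet)]
    rw [ENNReal.ofReal_mul (by positivity), ENNReal.ofReal_pow p.2.1,
      ENNReal.ofReal_pow (by linarith)]
    congr 2
    · exact (ENNReal.ofReal_eq_coe_nnreal p.2.1).symm
    · exact (ENNReal.ofReal_eq_coe_nnreal (σ p).2.1).symm
  refine h1.trans ?_
  rw [Finset.sum_congr rfl fun G _ => h2 G,
    ← ENNReal.ofReal_sum_of_nonneg fun G _ => wt_nonneg hp0 hp1 _ _]
  refine ENNReal.ofReal_le_ofReal ?_
  rw [← Finset.sum_image (f := wt (p : ℝ) (edges N)) (g := edgeF)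
    (fun _ _ _ _ h => edgeF_injective h)]
  refine Finset.sum_le_sum_of_subset_of_nonneg ?_ fun T _ _ => wt_nonneg hp0 hp1 _ T
  intro T hT
  obtain ⟨G, hG, rfl⟩ := Finset.mem_image.1 hT
  simp only [Finset.mem_filter, Finset.mem_univ, true_and, Finset.mem_powerset] at hG ⊢
  exact ⟨edgeF_subset G, hQ G hG⟩

theorem convex_schattenNorm_ball {α : ℝ} (hα : 1 ≤ α) {C : Matrix (Fin N) (Fin N) ℝ}
    (hC : C.IsHermitian) (δ : ℝ) :
    Convex ℝ {x | schattenNorm α ((isHermitian_toMat x).sub hC) ≤ δ} := by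
  intro x hx y hy a b ha hb hab
  simp only [Set.mem_ofPred_eq] at hx hy ⊢
  have hXh := (isHermitian_toMat x).sub hC
  have hYh := (isHermitian_toMat y).sub hC
  have h1 : toMat (a • x + b • y) - C = a • (toMat x - C) + b • (toMat y - C) := by
    rw [toMat_add, toMat_smul, toMat_smul, smul_sub, smul_sub]
    have : C = a • C + b • C := by rw [← add_smul, hab, one_smul]
    conv_lhs => rw [this]
    abel
  have ha' : (a • (toMat x - C)).IsHermitian := by
    rw [IsHermitian, conjTranspose_smul, hXh.eq, star_trivial]
  have hb' : (b • (toMat y - C)).IsHermitian := by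
    rw [IsHermitian, conjTranspose_smul, hYh.eq, star_trivial]
  rw [schattenNorm_congr α _ (ha'.add hb') h1]
  have h2 := schattenNorm_add_le hα ha' hb' (ha'.add hb')
  have h3 := schattenNorm_smul_le hα hXh a ha'
  have h4 := schattenNorm_smul_le hα hYh b hb'
  rw [abs_of_nonneg ha] at h3
  rw [abs_of_nonneg hb] at h4
  have h5 := mul_le_mul_of_nonneg_left hx ha
  have h6 := mul_le_mul_of_nonneg_left hy hb
  have h7 : a * δ + b * δ = δ := by rw [← add_mul, hab, one_mul]
  linarith

/-- The Schatten norm of the matrix of a function on edges. -/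
noncomputable def matNorm (α : ℝ) (x : Sym2 (Fin N) → ℝ) : ℝ := schattenNorm α (isHermitian_toMat x)

theorem schattenFun_adj (α : ℝ) (G : SimpleGraph (Fin N)) :
    schattenFun α N (adj G) = matNorm α (ind (edgeF G)) :=
  schattenNorm_congr α _ _ (adj_eq_toMat G)

/-- Two points of a ball of radius `δ` have norms within `2 * δ`, whatever the centre; this is the
relaxation in the variational problem. -/
theorem matNorm_le_add_of_near {α δ : ℝ} (hα : 1 ≤ α) {C : Matrix (Fin N) (Fin N) ℝ}
    (hC : C.IsHermitian) {x y : Sym2 (Fin N) → ℝ}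
    (hx : schattenNorm α ((isHermitian_toMat x).sub hC) ≤ δ)
    (hy : schattenNorm α ((isHermitian_toMat y).sub hC) ≤ δ) :
    matNorm α x ≤ matNorm α y + 2 * δ := by
  have hXh := (isHermitian_toMat x).sub hC
  have hYh := (isHermitian_toMat y).sub hC
  have hYh' := hC.sub (isHermitian_toMat y)
  have h1 : toMat x = toMat y + ((toMat x - C) + (C - toMat y)) := by abel
  have h2 := schattenNorm_add_le hα (isHermitian_toMat y) (hXh.add hYh')
    ((isHermitian_toMat y).add (hXh.add hYh'))
  have h3 := schattenNorm_add_le hα hXh hYh' (hXh.add hYh')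
  have h4 := schattenNorm_sub_comm_le hα hYh' hYh
  rw [matNorm, matNorm, schattenNorm_congr α _ ((isHermitian_toMat y).add (hXh.add hYh')) h1]
  linarith

/-- Covering by Schatten balls: if a random graph with property `Q` lies in one of finitely many
balls of radius `δ`, then the probability is controlled by the cost of the property `Q'`, a
`2δ`-relaxation of `Q`. -/
theorem Pr_cover_le {p : ℝ} (hp0 : 0 < p) (hp1 : p < 1) {α δ : ℝ} (hα : 1 ≤ α) {Z : Type*}
    [Fintype Z] (c : Z → Matrix (Fin N) (Fin N) ℝ) (hc : ∀ z, (c z).IsHermitian) (Q Q' : ℝ → Prop)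
    (hQ : ∀ a b, Q a → a ≤ b + 2 * δ → b ≤ a + 2 * δ → Q' b) {Φ : ℝ}
    (hΦ : ∀ x : Sym2 (Fin N) → ℝ, (∀ e, x e ∈ Set.Icc (0 : ℝ) 1) → Q' (matNorm α x) →
      Φ ≤ matEnt p (toMat x)) :
    Pr p (edges N) (fun T => ∃ z, Q (matNorm α (ind T)) ∧
      schattenNorm α ((isHermitian_toMat (ind T)).sub (hc z)) ≤ δ) ≤
      Fintype.card Z * Real.exp (-Φ) := by
  refine (Pr_exists_le hp0 hp1 _ _).trans ?_
  calc _ ≤ ∑ _z : Z, Real.exp (-Φ) := Finset.sum_le_sum fun z _ => ?_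
    _ = _ := by simp
  -- A ball that misses the event contributes nothing. Otherwise it contains a graph with property
  -- `Q`, so every point of the ball has property `Q'`, including the conditional mean supplied by
  -- the entropy bound.
  by_cases hne : ∃ T ⊆ edges N, Q (matNorm α (ind T)) ∧
      schattenNorm α ((isHermitian_toMat (ind T)).sub (hc z)) ≤ δ
  · obtain ⟨T₀, hT₀, hQ₀, hn₀⟩ := hne
    obtain ⟨x, hxK, hx01, hx⟩ := exists_mem_Pr_le_exp_neg hp0 hp1 (edges N)
      (convex_schattenNorm_ball hα (hc z) δ) ⟨T₀, hT₀, hn₀⟩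
    refine (Pr_mono hp0 hp1 fun T _ h => h.2).trans (hx.trans ?_)
    rw [Real.exp_le_exp, ← matEnt_toMat]
    have := hΦ x hx01 (hQ _ _ hQ₀ (matNorm_le_add_of_near hα (hc z) hn₀ hxK)
      (matNorm_le_add_of_near hα (hc z) hxK hn₀))
    linarith
  · have : Pr p (edges N) (fun T => Q (matNorm α (ind T)) ∧
        schattenNorm α ((isHermitian_toMat (ind T)).sub (hc z)) ≤ δ) = 0 := by
      by_contra h
      exact hne (exists_of_Pr_pos (lt_of_le_of_ne (Pr_nonneg hp0 hp1 _ _) (Ne.symm h)))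
    rw [this]
    exact (Real.exp_pos _).le

theorem toMat_ind_sub (T : Finset (Sym2 (Fin N))) (p : ℝ) :
    toMat (fun e => ind T e - p) = toMat (ind T) - toMat (fun _ => p) :=
  toMat_sub (ind T) (fun _ => p)

/-- The radius `δ` pays for three errors: the fluctuation ball around the mean matrix, the truncated
spectrum, and the rounding. The final summand is Talagrand's bound for graphs at squared distance
more than `u` from the fluctuation ball; the factor 2 in `2 * u` accounts for each edge filling two
entries. -/
theorem Pr_upper_le {p : ℝ} (hp0 : 0 < p) (hp1 : p < 1) (hN : 3 ≤ N) {α : ℝ} (hα : 2 ≤ α) {m k : ℕ}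
    (hm : α ≤ 2 * m) (hNp : 1 ≤ N * p) {u τ δ : ℝ} (hu : 0 ≤ u) (huN : 2 * u ≤ (N : ℝ) ^ 4)
    (hτ : 0 < τ) (hk : ∀ n : ℕ, n * τ ^ 2 ≤ 2 * u → n ≤ k)
    (hδ : ((1 + 2 * momentConst m) * N * (N * p) ^ (α / 2)) ^ (1 / α) +
      ((τ ^ (α - 2) * (2 * u)) ^ (1 / α) + 1) ≤ δ) {r Φ : ℝ}
    (hΦ : ∀ x : Sym2 (Fin N) → ℝ, (∀ e, x e ∈ Set.Icc (0 : ℝ) 1) → r - 2 * δ ≤ matNorm α x →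
      Φ ≤ matEnt p (toMat x)) :
    Pr p (edges N) (fun T => r ≤ matNorm α (ind T)) ≤
      Fintype.card (NetIdx N k) * Real.exp (-Φ) + 2 * Real.exp (-(u / 8)) := by
  have hα1 : 1 ≤ α := by linarith
  set C := toMat (N := N) (fun _ => p) with hCdef
  have hC : C.IsHermitian := isHermitian_toMat _
  set δ₁ := ((1 + 2 * (momentConst m : ℝ)) * N * (N * p) ^ (α / 2)) ^ (1 / α) with hδ₁
  set K : Set (Sym2 (Fin N) → ℝ) :=
    {x | schattenNorm α ((isHermitian_toMat x).sub hC) ≤ δ₁} with hK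
  have hKc : Convex ℝ K := convex_schattenNorm_ball hα1 hC δ₁
  have hhalf : 1 / 2 ≤ Pr p (edges N) (fun T => ind T ∈ K) := by
    refine (half_le_Pr_schattenNorm_le (N := N) hp0 hp1 hα1 m hm hNp).trans
      (Pr_mono hp0 hp1 fun T _ h => ?_)
    rw [schattenNorm_congr α _ ((isHermitian_toMat (ind T)).sub hC) (toMat_ind_sub T p)] at h
    exact h
  have htal := Pr_far_from_convex_le hp0 hp1 (edges N) hKc hhalf u
  have hc : ∀ z : NetIdx N k, (C + netMat z).IsHermitian := fun z => hC.add (isHermitian_netMat z)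
  have hcov := Pr_cover_le hp0 hp1 (δ := δ) hα1 (fun z : NetIdx N k => C + netMat z) hc
    (fun t => r ≤ t) (fun t => r - 2 * δ ≤ t) (fun a b h1 h2 _ => by linarith) hΦ
  refine le_trans ?_ (add_le_add hcov htal)
  refine le_trans (Pr_mono hp0 hp1 fun T hT h => ?_) (Pr_or_le hp0 hp1 _ _ _)
  by_cases hfar : ∃ y ∈ K, ∑ i ∈ edges N, (ind T i - y i) ^ 2 ≤ u
  · left
    obtain ⟨y, hyK, hyu⟩ := hfar
    have hR : (0 : ℝ) ≤ Real.sqrt (2 * u) := Real.sqrt_nonneg _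
    have hR2 : Real.sqrt (2 * u) ^ 2 = 2 * u := Real.sq_sqrt (by linarith [hu])
    obtain ⟨z, hz⟩ := exists_netMat_close hN hα hR (Real.sqrt_le_iff.2
      ⟨by positivity, by rw [← pow_mul]; exact huN⟩) hτ (by rw [hR2]; exact hk)
      (isHermitian_toMat (ind T - y)) (by
        rw [sum_sq_toMat, hR2]
        have : ∑ e ∈ edges N, (ind T - y) e ^ 2 ≤ u := hyu
        linarith)
    refine ⟨z, h, ?_⟩
    have h1 : toMat (ind T) - (C + netMat z) = (toMat y - C) + (toMat (ind T - y) - netMat z) := by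
      rw [toMat_sub]; abel
    have hz' := hz ((isHermitian_toMat (ind T - y)).sub (isHermitian_netMat z))
    rw [hR2] at hz'
    have hy' : schattenNorm α ((isHermitian_toMat y).sub hC) ≤ δ₁ := hyK
    have h2 := schattenNorm_add_le hα1 ((isHermitian_toMat y).sub hC)
      ((isHermitian_toMat (ind T - y)).sub (isHermitian_netMat z))
      (((isHermitian_toMat y).sub hC).add
        ((isHermitian_toMat (ind T - y)).sub (isHermitian_netMat z)))
    rw [schattenNorm_congr α _ (((isHermitian_toMat y).sub hC).add
        ((isHermitian_toMat (ind T - y)).sub (isHermitian_netMat z))) h1]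
    linarith
  · right; exact hfar

/-- Graphs with fewer than `u` edges have squared Hilbert–Schmidt norm at most `2 * u`, so the net
covers them without centring; the last summand is the Chernoff bound for the others. -/
theorem Pr_lower_le {p : ℝ} (hp0 : 0 < p) (hp1 : p < 1) (hN : 3 ≤ N) {α : ℝ} (hα : 2 ≤ α) {k : ℕ}
    {u τ δ : ℝ} (huN : 2 * u ≤ (N : ℝ) ^ 4)
    (hτ : 0 < τ) (hk : ∀ n : ℕ, n * τ ^ 2 ≤ 2 * u → n ≤ k)
    (hδ : (τ ^ (α - 2) * (2 * u)) ^ (1 / α) + 1 ≤ δ) {r Φ : ℝ}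
    (hΦ : ∀ x : Sym2 (Fin N) → ℝ, (∀ e, x e ∈ Set.Icc (0 : ℝ) 1) → matNorm α x ≤ r + 2 * δ →
      Φ ≤ matEnt p (toMat x)) :
    Pr p (edges N) (fun T => matNorm α (ind T) ≤ r) ≤
      Fintype.card (NetIdx N k) * Real.exp (-Φ) + Real.exp ((N : ℝ) ^ 2 * p - u) := by
  have hα1 : 1 ≤ α := by linarith
  have hcov := Pr_cover_le hp0 hp1 (δ := δ) hα1 (fun z : NetIdx N k => netMat z)
    isHermitian_netMat (fun t => t ≤ r) (fun t => t ≤ r + 2 * δ) (fun a b h1 _ h2 => by linarith) hΦ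
  have hch := Pr_card_ge_le hp0 hp1 (edges N) u
  have hch' : Real.exp (2 * p * (edges N).card - u) ≤ Real.exp ((N : ℝ) ^ 2 * p - u) := by
    rw [Real.exp_le_exp]
    nlinarith [card_edges_le N]
  refine le_trans ?_ (add_le_add hcov (hch.trans hch'))
  refine le_trans (Pr_mono hp0 hp1 fun T hT h => ?_) (Pr_or_le hp0 hp1 _ _ _)
  by_cases hfar : u ≤ T.card
  · right; exact hfar
  · left
    push Not at hfar
    have hR : (0 : ℝ) ≤ Real.sqrt (2 * u) := Real.sqrt_nonneg _
    have hR2 : Real.sqrt (2 * u) ^ 2 = 2 * u := Real.sq_sqrt (by linarith [Nat.cast_nonneg (α := ℝ) T.card])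
    obtain ⟨z, hz⟩ := exists_netMat_close hN hα hR (Real.sqrt_le_iff.2
      ⟨by positivity, by rw [← pow_mul]; exact huN⟩) hτ (by rw [hR2]; exact hk)
      (isHermitian_toMat (ind T)) (by
        rw [sum_sq_toMat, hR2]
        have : ∑ e ∈ edges N, ind T e ^ 2 = T.card := by
          simp only [ind, ite_pow, one_pow, ne_eq, OfNat.ofNat_ne_zero, not_false_eq_true, zero_pow]
          rw [Finset.sum_ite_mem, Finset.inter_eq_right.2 hT]; simp
        linarith)
    refine ⟨z, h, ?_⟩
    have hz' := hz ((isHermitian_toMat (ind T)).sub (isHermitian_netMat z))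
    rw [hR2] at hz'
    exact hz'.trans hδ

theorem relEnt_nonneg {p x : ℝ} (hp0 : 0 < p) (hp1 : p < 1) (hx : x ∈ Set.Icc (0 : ℝ) 1) :
    0 ≤ relEnt p x := by
  -- The terms a - b for the two outcomes cancel in the relative entropy.
  have key : ∀ a b : ℝ, 0 ≤ a → 0 < b → a - b ≤ a * Real.log (a / b) := by
    intro a b ha hb
    rcases eq_or_lt_of_le ha with h | h
    · rw [← h]; simp; linarith
    · have h1 := Real.one_sub_inv_le_log_of_pos (div_pos h hb)
      have h2 := mul_le_mul_of_nonneg_left h1 ha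
      have h3 : a * (1 - (a / b)⁻¹) = a - b := by field_simp
      linarith
  have h1 := key x p hx.1 hp0
  have h2 := key (1 - x) (1 - p) (by linarith [hx.2]) (by linarith)
  unfold relEnt
  linarith

theorem matEnt_nonneg {p : ℝ} (hp0 : 0 < p) (hp1 : p < 1) (X : cX N) :
    0 ≤ matEnt p (X : Matrix (Fin N) (Fin N) ℝ) :=
  Finset.sum_nonneg fun i _ => Finset.sum_nonneg fun j _ => relEnt_nonneg hp0 hp1 (X.2.2.2 i j)

/-- A feasible variational problem has a finite value. -/
theorem exists_real_eq_iInf_matEnt {p : ℝ} (hp0 : 0 < p) (hp1 : p < 1) (P : cX N → Prop)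
    {X₀ : cX N} (h₀ : P X₀) :
    ∃ Φ : ℝ, (⨅ (X : cX N) (_ : P X), (matEnt p (X : Matrix (Fin N) (Fin N) ℝ) : EReal)) = Φ ∧
      ∀ X : cX N, P X → Φ ≤ matEnt p (X : Matrix (Fin N) (Fin N) ℝ) := by
  set v := ⨅ (X : cX N) (_ : P X), (matEnt p (X : Matrix (Fin N) (Fin N) ℝ) : EReal) with hv
  have hle : ∀ X : cX N, P X → v ≤ (matEnt p (X : Matrix (Fin N) (Fin N) ℝ) : EReal) :=
    fun X hX => iInf₂_le X hX
  have h0 : (0 : EReal) ≤ v := le_iInf₂ fun X _ => by exact_mod_cast matEnt_nonneg hp0 hp1 X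
  have htop : v ≠ ⊤ := ((hle X₀ h₀).trans_lt (EReal.coe_lt_top _)).ne
  have hbot : v ≠ ⊥ := (lt_of_lt_of_le EReal.bot_lt_zero h0).ne'
  have hcoe := EReal.coe_toReal htop hbot
  refine ⟨v.toReal, hcoe.symm, fun X hX => ?_⟩
  have := hle X hX
  rw [← hcoe] at this
  exact_mod_cast this

/-- Planting a clique on `k` vertices. -/
theorem exists_clique_feasible {p : ℝ} (hp0 : 0 < p) (hp1 : p < 1) {α : ℝ} (hα : 1 ≤ α) {k : ℕ}
    (hk0 : 0 < k) (hkN : k ≤ N) :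
    ∃ x : Sym2 (Fin N) → ℝ, (∀ e, x e ∈ Set.Icc (0 : ℝ) 1) ∧ (k : ℝ) - 1 ≤ matNorm α x ∧
      matEnt p (toMat x) ≤ (k : ℝ) ^ 2 * Real.log (1 / p) := by
  classical
  obtain ⟨K, -, hK⟩ := Finset.exists_subset_card_eq (s := (Finset.univ : Finset (Fin N)))
    (n := k) (by simpa using hkN)
  -- Off the clique the entries equal `p` and cost nothing.
  set x : Sym2 (Fin N) → ℝ := fun e => if ∀ v ∈ e, v ∈ K then 1 else p with hx
  have hxs : ∀ i j, x s(i, j) = if i ∈ K ∧ j ∈ K then 1 else p := by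
    intro i j; simp [hx]
  have hkr : (0 : ℝ) < k := by exact_mod_cast hk0
  have hL : 0 ≤ Real.log (1 / p) := Real.log_nonneg (by rw [le_div_iff₀ hp0]; linarith)
  refine ⟨x, fun e => ?_, ?_, ?_⟩
  · simp only [hx]; split_ifs
    · simp
    · exact ⟨hp0.le, hp1.le⟩
  · set v : Fin N → ℝ := fun i => if i ∈ K then 1 / Real.sqrt k else 0 with hv
    have hsq : (1 / Real.sqrt k) ^ 2 = 1 / (k : ℝ) := by
      rw [div_pow, one_pow, Real.sq_sqrt hkr.le]
    have hv1 : ∑ i, v i ^ 2 = 1 := by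
      simp only [hv, ite_pow, hsq]
      simp [hK]
      field_simp
    refine le_trans (le_of_eq ?_) ((le_abs_self _).trans
      (abs_quadratic_le_schattenNorm hα (isHermitian_toMat x) v hv1))
    have h1 : ∀ i j, v i * toMat x i j * v j =
        if i ∈ K then (if j ∈ K then 1 / (k : ℝ) - (if i = j then 1 / (k : ℝ) else 0) else 0)
        else 0 := by
      intro i j
      by_cases hi : i ∈ K <;> by_cases hj : j ∈ K <;> by_cases hij : i = j <;>
        simp [hv, hi, hj, hij, toMat, hxs]
      rw [← mul_inv, Real.mul_self_sqrt hkr.le]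
    simp only [h1]
    have h2 : ∀ i ∈ K, ∑ j ∈ K, (1 / (k : ℝ) - (if i = j then 1 / (k : ℝ) else 0)) =
        1 - 1 / (k : ℝ) := by
      intro i hi
      rw [Finset.sum_sub_distrib, Finset.sum_ite_eq, if_pos hi, Finset.sum_const, hK,
        nsmul_eq_mul, mul_one_div_cancel hkr.ne']
    have h3 : ∀ i, ∑ j, (if i ∈ K then (if j ∈ K then 1 / (k : ℝ) -
        (if i = j then 1 / (k : ℝ) else 0) else 0) else 0) =
        if i ∈ K then 1 - 1 / (k : ℝ) else 0 := by
      intro i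
      by_cases hi : i ∈ K
      · simp only [hi, if_true]
        rw [Finset.sum_ite_mem, Finset.univ_inter, h2 i hi]
      · simp [hi]
    rw [Finset.sum_congr rfl fun i _ => h3 i, Finset.sum_ite_mem, Finset.univ_inter,
      Finset.sum_const, hK, nsmul_eq_mul]
    field_simp
  · have h1 : ∀ i j, relEnt p (x s(i, j)) ≤
        if i ∈ K then (if j ∈ K then Real.log (1 / p) else 0) else 0 := by
      intro i j
      have hpp : relEnt p p = 0 := by
        rw [relEnt, div_self hp0.ne', div_self (by linarith : (1 : ℝ) - p ≠ 0)]; simp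
      rw [hxs]
      by_cases hi : i ∈ K <;> by_cases hj : j ∈ K <;> simp [hi, hj, hpp]
      simp [relEnt]
    rw [matEnt]
    calc _ ≤ ∑ i : Fin N, ∑ j : Fin N,
          (if i ∈ K then (if j ∈ K then Real.log (1 / p) else 0) else 0) := by
          refine Finset.sum_le_sum fun i _ => ?_
          refine (Finset.sum_le_sum (g := fun j => if i ∈ K then
            (if j ∈ K then Real.log (1 / p) else 0) else 0) fun j hj => ?_).trans
            (Finset.sum_le_sum_of_subset_of_nonneg (Finset.subset_univ _) fun j _ _ => ?_)
          · have : toMat x i j = x s(i, j) := by simp [toMat, (Finset.mem_Ioi.1 hj).ne]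
            rw [this]; exact h1 i j
          · split_ifs <;> first | exact hL | exact le_rfl
      _ = _ := by
          simp [hK]; ring

/-- The empty graph is feasible for the lower tail. -/
theorem zero_feasible {p : ℝ} (hp0 : 0 < p) (hp2 : p ≤ 1 / 2) {α : ℝ} (hα : 2 ≤ α) :
    matNorm α (0 : Sym2 (Fin N) → ℝ) ≤ 0 ∧
      matEnt p (toMat (0 : Sym2 (Fin N) → ℝ)) ≤ (N : ℝ) ^ 2 * p := by
  constructor
  · exact schattenNorm_le_of_sum_sq_le hα _ le_rfl (by rw [sum_sq_toMat]; simp)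
  · rw [matEnt_toMat]
    have h1 : relEnt p 0 ≤ 2 * p := by
      have h2 := Real.one_sub_inv_le_log_of_pos (show 0 < 1 - p by linarith)
      have h3 : (1 - p)⁻¹ ≤ 1 + 2 * p := by
        rw [inv_le_comm₀ (by linarith) (by linarith), inv_le_iff_one_le_mul₀ (by linarith)]
        nlinarith
      simp [relEnt]
      linarith
    calc ∑ e ∈ edges N, relEnt p ((0 : Sym2 (Fin N) → ℝ) e) ≤ ∑ _e ∈ edges N, 2 * p :=
          Finset.sum_le_sum fun e _ => by simpa using h1
      _ = (edges N).card * (2 * p) := by simp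
      _ ≤ (N : ℝ) ^ 2 / 2 * (2 * p) := by gcongr; exact card_edges_le N
      _ = _ := by ring

end Finite

/-! ### Absorbing the net and the exceptional events into the error term -/

section Assembly

open Matrix MeasureTheory unitInterval

variable {N : ℕ}

/-- The net costs 14 k N log N in the exponent; the extra 1 in `E` pays for the second summand. -/
theorem le_exp_of_le_card_mul_exp {k : ℕ} (hN : 3 ≤ N) {P Φ E : ℝ}
    (hP : P ≤ Fintype.card (NetIdx N k) * Real.exp (-Φ) + Real.exp (-Φ))
    (hE : 1 + 14 * k * N * Real.log N ≤ E) : P ≤ Real.exp (-Φ + E) := by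
  have h1 := log_card_netIdx_le k hN
  have h0 : 0 ≤ 14 * k * N * Real.log N := by
    have := Real.log_nonneg (show (1 : ℝ) ≤ N by exact_mod_cast (by omega : 1 ≤ N))
    positivity
  have h2 : (1 : ℝ) ≤ Real.exp (14 * k * N * Real.log N) := Real.one_le_exp h0
  have h3 : (2 : ℝ) ≤ Real.exp 1 := by linarith [Real.add_one_le_exp (1 : ℝ)]
  have h4 : (Fintype.card (NetIdx N k) : ℝ) + 1 ≤ Real.exp E := by
    calc _ ≤ 2 * Real.exp (14 * k * N * Real.log N) := by linarith
      _ ≤ Real.exp 1 * Real.exp (14 * k * N * Real.log N) := by gcongr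
      _ = Real.exp (1 + 14 * k * N * Real.log N) := by rw [Real.exp_add]
      _ ≤ _ := Real.exp_le_exp.2 hE
  rw [Real.exp_add]
  calc P ≤ Real.exp (-Φ) * (Fintype.card (NetIdx N k) + 1) := by linarith
    _ ≤ _ := by gcongr

/-- The upper tail bound for a fixed number of vertices. -/
theorem binomialRandom_upper_le {p : I} (hp0 : 0 < (p : ℝ)) (hp1 : (p : ℝ) < 1) (hN : 3 ≤ N)
    {α : ℝ} (hα : 2 ≤ α) {m k : ℕ} (hm : α ≤ 2 * m) (hNp : 1 ≤ N * (p : ℝ)) {s ε E u τ : ℝ}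
    (hs : 1 ≤ s) (hε : 0 ≤ ε) (hsp : 3 * s * p ≤ 1)
    (hL : 1 ≤ Real.log (1 / (p : ℝ)))
    (hu : u = 8 * (9 * s ^ 2 + 1) * ((N : ℝ) ^ 2 * (p : ℝ) ^ 2 * Real.log (1 / (p : ℝ))))
    (huN : 2 * u ≤ (N : ℝ) ^ 4) (hτ : 0 < τ) (hk : ∀ n : ℕ, n * τ ^ 2 ≤ 2 * u → n ≤ k)
    (hδ : ((1 + 2 * momentConst m) * N * (N * (p : ℝ)) ^ (α / 2)) ^ (1 / α) +
      ((τ ^ (α - 2) * (2 * u)) ^ (1 / α) + 1) ≤ N * p * ε / 2)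
    (hE : 1 + 14 * k * N * Real.log N ≤ E) :
    SimpleGraph.binomialRandom (Fin N) p {G | N * (s * p) ≤ schattenFun α N (adj G)} ≤
      EReal.exp (-phi (schattenFun α N) p (N * ((s - ε) * p)) + (E : EReal)) := by
  have hα1 : 1 ≤ α := by linarith
  have hN0 : (0 : ℝ) < N := by exact_mod_cast (by omega : 0 < N)
  set L := Real.log (1 / (p : ℝ)) with hLdef
  -- a feasible planted clique
  set j := ⌈s * (N * (p : ℝ))⌉₊ + 1 with hj
  have hsNp : 1 ≤ s * (N * (p : ℝ)) := by nlinarith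
  have hj1 : (j : ℝ) ≤ 3 * (s * (N * p)) := by
    have := (Nat.ceil_lt_add_one (by linarith : 0 ≤ s * (N * (p : ℝ)))).le
    rw [hj]; push_cast; linarith
  have hjN : j ≤ N := by
    have : (j : ℝ) ≤ N := by
      refine hj1.trans ?_
      calc 3 * (s * (N * (p : ℝ))) = N * (3 * s * p) := by ring
        _ ≤ N * 1 := by gcongr
        _ = N := mul_one _
    exact_mod_cast this
  obtain ⟨x₀, hx₀, hx₀n, hx₀e⟩ := exists_clique_feasible hp0 hp1 hα1 (k := j) (by omega) hjN
  have hj2 : s * (N * (p : ℝ)) ≤ (j : ℝ) - 1 := by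
    have := Nat.le_ceil (s * (N * (p : ℝ)))
    rw [hj]; push_cast; linarith
  have hfeas : N * ((s - ε) * (p : ℝ)) ≤ schattenFun α N ⟨toMat x₀, toMat_mem_cX hx₀⟩ := by
    have h1 : N * ((s - ε) * (p : ℝ)) ≤ s * (N * p) := by
      have : 0 ≤ N * (p : ℝ) * ε := by positivity
      linarith
    exact h1.trans (hj2.trans hx₀n)
  obtain ⟨Φ, hΦ, hΦle⟩ := exists_real_eq_iInf_matEnt hp0 hp1
    (fun X => N * ((s - ε) * (p : ℝ)) ≤ schattenFun α N X) hfeas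
  have hΦ' : phi (schattenFun α N) p (N * ((s - ε) * p)) = Φ := hΦ
  have hΦu : Φ ≤ 9 * s ^ 2 * ((N : ℝ) ^ 2 * (p : ℝ) ^ 2 * L) := by
    refine (hΦle _ hfeas).trans (hx₀e.trans ?_)
    calc (j : ℝ) ^ 2 * L ≤ (3 * (s * (N * p))) ^ 2 * L := by gcongr
      _ = _ := by ring
  have hg : 1 ≤ (N : ℝ) ^ 2 * (p : ℝ) ^ 2 * L := by
    have : 1 ≤ (N * (p : ℝ)) ^ 2 := one_le_pow₀ hNp
    rw [← mul_pow]; nlinarith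
  have hu0 : 0 ≤ u := by rw [hu]; positivity
  have hPr := Pr_upper_le hp0 hp1 hN hα hm hNp hu0 huN hτ hk hδ (r := N * (s * p)) (Φ := Φ) (by
    intro x hx hxn
    refine hΦle ⟨toMat x, toMat_mem_cX hx⟩ (le_trans (le_of_eq ?_) hxn)
    ring)
  -- `u` is chosen so that u/8 exceeds the clique bound on `Φ` by N²p² log(1/p) ≥ 1, which absorbs
  -- the factor 2.
  have hbad : 2 * Real.exp (-(u / 8)) ≤ Real.exp (-Φ) := by
    have h3 : (2 : ℝ) ≤ Real.exp 1 := by linarith [Real.add_one_le_exp (1 : ℝ)]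
    calc 2 * Real.exp (-(u / 8)) ≤ Real.exp 1 * Real.exp (-(u / 8)) := by gcongr
      _ = Real.exp (1 - u / 8) := by rw [← Real.exp_add]; ring_nf
      _ ≤ _ := by
          rw [Real.exp_le_exp, hu]
          linarith
  have hfin := le_exp_of_le_card_mul_exp (k := k) hN (hPr.trans (add_le_add_right hbad _)) hE
  rw [hΦ', ← EReal.coe_neg, ← EReal.coe_add, EReal.exp_coe]
  refine (binomialRandom_le_Pr p _ (fun T => N * (s * p) ≤ matNorm α (ind T)) ?_ hp0 hp1).trans
    (ENNReal.ofReal_le_ofReal hfin)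
  intro G hG
  rw [← schattenFun_adj]
  exact hG

/-- The lower tail bound for a fixed number of vertices. -/
theorem binomialRandom_lower_le {p : I} (hp0 : 0 < (p : ℝ)) (hp2 : (p : ℝ) ≤ 1 / 2) (hN : 3 ≤ N)
    {α : ℝ} (hα : 2 ≤ α) {k : ℕ} {s ε E τ : ℝ} (hs : 0 ≤ s) (hε : 0 ≤ ε)
    (hτ : 0 < τ) (hk : ∀ n : ℕ, n * τ ^ 2 ≤ 4 * ((N : ℝ) ^ 2 * p) → n ≤ k)
    (hδ : (τ ^ (α - 2) * (4 * ((N : ℝ) ^ 2 * p))) ^ (1 / α) + 1 ≤ N * p * ε / 2)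
    (hE : 1 + 14 * k * N * Real.log N ≤ E) :
    SimpleGraph.binomialRandom (Fin N) p {G | schattenFun α N (adj G) ≤ N * (s * p)} ≤
      EReal.exp (-psi (schattenFun α N) p (N * ((s + ε) * p)) + (E : EReal)) := by
  have hp1 : (p : ℝ) < 1 := by linarith
  have hN0 : (0 : ℝ) < N := by exact_mod_cast (by omega : 0 < N)
  have hN3 : (3 : ℝ) ≤ N := by exact_mod_cast hN
  obtain ⟨hz, hze⟩ := zero_feasible (N := N) hp0 hp2 hα
  have hfeas : schattenFun α N ⟨toMat 0, toMat_mem_cX (by simp)⟩ ≤ N * ((s + ε) * (p : ℝ)) := by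
    have : 0 ≤ N * ((s + ε) * (p : ℝ)) := by positivity
    exact le_trans hz this
  obtain ⟨Φ, hΦ, hΦle⟩ := exists_real_eq_iInf_matEnt hp0 hp1
    (fun X => schattenFun α N X ≤ N * ((s + ε) * (p : ℝ))) hfeas
  have hΦ' : psi (schattenFun α N) p (N * ((s + ε) * p)) = Φ := hΦ
  have hΦu : Φ ≤ (N : ℝ) ^ 2 * p := (hΦle _ hfeas).trans hze
  -- Twice N²p, so the Chernoff exponent N²p - u equals -N²p, at most -Φ.
  set u := 2 * ((N : ℝ) ^ 2 * p) with hu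
  have h2u : 2 * u = 4 * ((N : ℝ) ^ 2 * p) := by rw [hu]; ring
  have huN : 2 * u ≤ (N : ℝ) ^ 4 := by
    rw [h2u]
    have h9 : (9 : ℝ) ≤ (N : ℝ) ^ 2 := by nlinarith
    nlinarith [mul_le_mul_of_nonneg_left hp2 (sq_nonneg (N : ℝ)),
      mul_le_mul_of_nonneg_left h9 (sq_nonneg (N : ℝ))]
  have hPr := Pr_lower_le hp0 hp1 hN hα (k := k) (δ := N * p * ε / 2) huN hτ
    (by rw [h2u]; exact hk) (by rw [h2u]; exact hδ) (r := N * (s * p)) (Φ := Φ) (by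
    intro x hx hxn
    refine hΦle ⟨toMat x, toMat_mem_cX hx⟩ (le_trans hxn (le_of_eq ?_))
    ring)
  have hbad : Real.exp ((N : ℝ) ^ 2 * p - u) ≤ Real.exp (-Φ) := by
    rw [Real.exp_le_exp, hu]; linarith
  have hfin := le_exp_of_le_card_mul_exp (k := k) hN (hPr.trans (add_le_add_right hbad _)) hE
  rw [hΦ', ← EReal.coe_neg, ← EReal.coe_add, EReal.exp_coe]
  refine (binomialRandom_le_Pr p _ (fun T => matNorm α (ind T) ≤ N * (s * p)) ?_ hp0 hp1).trans
    (ENNReal.ofReal_le_ofReal hfin)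
  intro G hG
  rw [← schattenFun_adj]
  exact hG

end Assembly

/-! ### Choice of the truncation level and the limits -/

section Asymptotics

open unitInterval

theorem exists_exp_eq {x : ℝ} (hx : 0 < x) : ∃ y, x = Real.exp y := ⟨Real.log x, (Real.exp_log hx).symm⟩

/-- The fluctuation radius relative to Np is a power of N^(2/α-1)/p, which tends to 0 by hypothesis.
Writing the variables as exponentials turns the identity into linear algebra of exponents. -/
theorem bulk_term_eq {n p C α : ℝ} (hn : 0 < n) (hp : 0 < p) (hC : 0 < C) (hα : 0 < α) :
    (C * n * (n * p) ^ (α / 2)) ^ (1 / α) =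
      n * p * (C ^ (1 / α) * (n ^ (2 / α - 1) / p) ^ (1 / 2 : ℝ)) := by
  obtain ⟨x, rfl⟩ := exists_exp_eq hn
  obtain ⟨y, rfl⟩ := exists_exp_eq hp
  obtain ⟨c, rfl⟩ := exists_exp_eq hC
  simp only [← Real.exp_add, ← Real.exp_mul, ← Real.exp_sub]
  congr 1
  field_simp
  ring

/-- `b` is the ratio of the second threshold to p. With τ² = N log N / b the truncation error keeps
b^((α-2)/2) out of a total gain b^(α-2), while the entropy relative to the rate gains a factor `b`.
-/
theorem upper_tail_term_eq {n p l b α : ℝ} (hn : 0 < n) (hp : 0 < p) (hl : 0 < l) (hα : 2 < α)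
    (hb : b = l ^ (α / (2 * α - 4)) / Real.sqrt n / p) :
    Real.sqrt (n * l / b) ^ (α - 2) * (n ^ 2 * p ^ 2 * l) = (n * p) ^ α * b ^ ((α - 2) / 2) := by
  have h2 : 2 * α - 4 ≠ 0 := by linarith
  obtain ⟨x, rfl⟩ := exists_exp_eq hn
  obtain ⟨y, rfl⟩ := exists_exp_eq hp
  obtain ⟨z, rfl⟩ := exists_exp_eq hl
  rw [← Real.exp_half, ← Real.exp_mul, ← Real.exp_sub, ← Real.exp_sub] at hb
  subst hb
  rw [← Real.exp_add, ← Real.exp_sub, ← Real.exp_half]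
  simp only [← Real.exp_add, ← Real.exp_mul, ← Real.exp_nat_mul]
  congr 1
  push_cast
  have h3 : z * (α / (2 * α - 4)) * (α - 2) = z * α / 2 := by
    rw [show 2 * α - 4 = 2 * (α - 2) by ring]
    have : α - 2 ≠ 0 := by linarith
    field_simp
  linear_combination (-1 : ℝ) * h3

/-- The gain b^(α-1) is again split evenly: dividing τ² by b^((α-1)/(α-2)) gives that factor to the
entropy and leaves b^((α-1)/2) for the truncation error. -/
theorem lower_tail_term_eq {n p l b α : ℝ} (hn : 0 < n) (hp : 0 < p) (hl : 0 < l) (hα : 2 < α)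
    (hb : b = (l / n) ^ ((α - 2) / (2 * α - 2)) / p) :
    Real.sqrt (n * l / b ^ ((α - 1) / (α - 2))) ^ (α - 2) * (n ^ 2 * p) =
      (n * p) ^ α * b ^ ((α - 1) / 2) := by
  have h2 : α - 2 ≠ 0 := by linarith
  have h1 : α - 1 ≠ 0 := by linarith
  obtain ⟨x, rfl⟩ := exists_exp_eq hn
  obtain ⟨y, rfl⟩ := exists_exp_eq hp
  obtain ⟨z, rfl⟩ := exists_exp_eq hl
  rw [← Real.exp_sub, ← Real.exp_mul, ← Real.exp_sub] at hb
  subst hb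
  rw [← Real.exp_add, ← Real.exp_mul, ← Real.exp_sub, ← Real.exp_half]
  simp only [← Real.exp_add, ← Real.exp_mul, ← Real.exp_nat_mul]
  congr 1
  push_cast
  rw [show 2 * α - 2 = 2 * (α - 1) by ring]
  field_simp
  ring

theorem tail_term_le {n p c b' A M α : ℝ} (hnp : 0 ≤ n * p) (hα : 0 < α) (hA : 0 ≤ A)
    (hb : 0 ≤ c * b') (h : A ≤ M * c) (hM : M = (n * p) ^ α * b') :
    A ^ (1 / α) ≤ n * p * (c * b') ^ (1 / α) := by
  calc A ^ (1 / α) ≤ ((n * p) ^ α * (c * b')) ^ (1 / α) := by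
        refine Real.rpow_le_rpow hA (h.trans (le_of_eq ?_)) (by positivity)
        rw [hM]; ring
    _ = _ := by
        rw [Real.mul_rpow (Real.rpow_nonneg hnp _) hb, ← Real.rpow_mul hnp,
          mul_one_div_cancel hα.ne', Real.rpow_one]

theorem natFloor_le_bounds {x τ : ℝ} (hτ : 0 < τ) (n : ℕ) (h : n * τ ^ 2 ≤ x) :
    n ≤ ⌊x / τ ^ 2⌋₊ :=
  Nat.le_floor (by rwa [le_div_iff₀ (by positivity)])

theorem tendsto_rpow_zero {f : ℕ → ℝ} (hf : Tendsto f atTop (𝓝 0)) {r : ℝ} (hr : 0 < r) :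
    Tendsto (fun N => f N ^ r) atTop (𝓝 0) := by
  have := hf.rpow_const (p := r) (Or.inr hr.le)
  rwa [Real.zero_rpow hr.ne'] at this

theorem upper_tail (α : ℝ) (hα : 2 < α) (p : ℕ → I)
    (hp0 : ∀ N, 0 < (p N : ℝ)) (hp1 : ∀ N, (p N : ℝ) < 1)
    (hp : Tendsto (fun N => (p N : ℝ)) atTop (𝓝 0))
    (hlarge : (fun N : ℕ => max ((N : ℝ) ^ (2 / α - 1))
          (Real.log N ^ (α / (2 * α - 4)) / Real.sqrt N)) =o[atTop] fun N => (p N : ℝ))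
    (s : ℝ) (hs : 1 < s) : ∃ ε E : ℕ → ℝ,
        Tendsto ε atTop (𝓝 0) ∧
        (E =o[atTop] fun N : ℕ => (N : ℝ) ^ 2 * (p N : ℝ) ^ 2 * Real.log (1 / (p N : ℝ))) ∧
        ∀ᶠ N : ℕ in atTop,
          SimpleGraph.binomialRandom (Fin N) (p N)
              {G | N * (s * p N) ≤ schattenFun α N (adj G)} ≤
            EReal.exp
              (-phi (schattenFun α N) (p N) (N * ((s - ε N) * p N)) + (E N : EReal)) := by
  set a : ℕ → ℝ := fun N => (N : ℝ) ^ (2 / α - 1) / p N with ha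
  set b : ℕ → ℝ := fun N => Real.log N ^ (α / (2 * α - 4)) / Real.sqrt N / p N with hb
  have hmax := hlarge.tendsto_div_nhds_zero
  have ha0 : ∀ N, 0 ≤ a N := fun N =>
    div_nonneg (Real.rpow_nonneg (Nat.cast_nonneg N) _) (hp0 N).le
  have hlog0 : ∀ N : ℕ, 0 ≤ Real.log N := fun N => Real.log_natCast_nonneg N
  have hb0 : ∀ N, 0 ≤ b N := fun N => div_nonneg (div_nonneg (Real.rpow_nonneg (hlog0 N) _)
    (Real.sqrt_nonneg _)) (hp0 N).le
  have hat : Tendsto a atTop (𝓝 0) := squeeze_zero ha0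
    (fun N => div_le_div_of_nonneg_right (le_max_left _ _) (hp0 N).le) hmax
  have hbt : Tendsto b atTop (𝓝 0) := squeeze_zero hb0
    (fun N => div_le_div_of_nonneg_right (le_max_right _ _) (hp0 N).le) hmax
  set g : ℕ → ℝ := fun N => (N : ℝ) ^ 2 * (p N : ℝ) ^ 2 * Real.log (1 / (p N : ℝ)) with hg
  obtain ⟨m, hm⟩ := exists_nat_ge (α / 2)
  set C : ℝ := 1 + 2 * momentConst m with hC
  have hC0 : 0 < C := by positivity
  set c : ℝ := 8 * (9 * s ^ 2 + 1) with hc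
  have hc0 : 0 < c := by positivity
  have hLt : Tendsto (fun N => Real.log (1 / (p N : ℝ))) atTop atTop := by
    have h1 : Tendsto (fun N => (p N : ℝ)) atTop (𝓝[>] 0) :=
      tendsto_nhdsWithin_iff.2 ⟨hp, Eventually.of_forall hp0⟩
    have h2 := Real.tendsto_log_nhdsGT_zero.comp h1
    refine (tendsto_neg_atBot_atTop.comp h2).congr fun N => ?_
    simp [Real.log_inv]
  -- N p a = N^(2/α) ≥ 1, so the rounding error 1 is at most Np · a = o(Np).
  have hNp : ∀ᶠ N : ℕ in atTop, 1 ≤ N * (p N : ℝ) ∧ 1 ≤ N * (p N : ℝ) * a N := by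
    filter_upwards [hat.eventually (ge_mem_nhds zero_lt_one), eventually_ge_atTop 1] with N h1 h2
    have hN : (1 : ℝ) ≤ N := by exact_mod_cast h2
    have h3 : N * (p N : ℝ) * a N = (N : ℝ) ^ (2 / α) := by
      rw [ha]; dsimp only
      have := (hp0 N).ne'
      rw [Real.rpow_sub (by linarith), Real.rpow_one]
      field_simp
    have h4 : (1 : ℝ) ≤ (N : ℝ) ^ (2 / α) := Real.one_le_rpow hN (by positivity)
    have h5 : 0 ≤ N * (p N : ℝ) := mul_nonneg (by linarith) (hp0 N).le
    refine ⟨?_, by rw [h3]; exact h4⟩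
    rw [← h3] at h4
    nlinarith [ha0 N]
  have hgt : Tendsto g atTop atTop := by
    refine tendsto_atTop_mono' _ ?_ hLt
    filter_upwards [hNp, hLt.eventually_ge_atTop 0] with N h1 h2
    have : 1 ≤ (N * (p N : ℝ)) ^ 2 := one_le_pow₀ h1.1
    rw [hg]; dsimp only
    rw [← mul_pow]
    nlinarith
  -- The summands of ε are the fluctuation radius, the truncation error and the rounding error, all
  -- relative to Np; the factor 2 is the 2δ-relaxation. In E the constant 28 is 14 · 2, with the net
  -- size k at most 2c g / τ².
  refine ⟨fun N => 2 * (C ^ (1 / α) * a N ^ (1 / 2 : ℝ) +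
      (2 * c * b N ^ ((α - 2) / 2)) ^ (1 / α) + a N), fun N => 1 + 28 * c * b N * g N, ?_, ?_, ?_⟩
  · have h1 := (tendsto_rpow_zero hat (r := 1 / 2) (by norm_num)).const_mul (C ^ (1 / α))
    have h2 := tendsto_rpow_zero (((tendsto_rpow_zero hbt (r := (α - 2) / 2)
      (by linarith)).const_mul (2 * c)).trans (by simp)) (r := 1 / α) (by positivity)
    have h3 := ((h1.add h2).add hat).const_mul 2
    simpa using h3
  · refine IsLittleO.add (isLittleO_const_left.2 (Or.inr ?_)) ?_
    · exact tendsto_norm_atTop_atTop.comp hgt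
    · have h1 : (fun N => 28 * c * b N) =o[atTop] fun _ : ℕ => (1 : ℝ) := by
        rw [isLittleO_one_iff]
        simpa using hbt.const_mul (28 * c)
      simpa using h1.mul_isBigO (isBigO_refl g atTop)
  · have hp3 : ∀ᶠ N in atTop, (p N : ℝ) ≤ 1 / (3 * s) :=
      hp.eventually (ge_mem_nhds (by positivity))
    filter_upwards [hNp, hp3, eventually_ge_atTop 3, hLt.eventually_ge_atTop 1,
      (tendsto_natCast_atTop_atTop (R := ℝ)).eventually_ge_atTop (2 * c)] with N h1 h2 hN hL hNc
    have hN3 : (3 : ℝ) ≤ N := by exact_mod_cast hN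
    have hN0 : (0 : ℝ) < N := by linarith
    have hl : 0 < Real.log N := Real.log_pos (by linarith)
    have hq := hp0 N
    have hbpos : 0 < b N := by
      rw [hb]; dsimp only
      have := Real.rpow_pos_of_pos hl (α / (2 * α - 4))
      positivity
    set τ := Real.sqrt (N * Real.log N / b N) with hτ
    have hτ0 : 0 < τ := Real.sqrt_pos.2 (by positivity)
    have hτ2 : τ ^ 2 = N * Real.log N / b N := Real.sq_sqrt (by positivity)
    -- Follows from Np ≥ 1, and lets log N replace log(1/p) in the truncation error.
    have hLl : Real.log (1 / (p N : ℝ)) ≤ Real.log N := by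
      refine Real.log_le_log (by positivity) ?_
      rw [div_le_iff₀ hq]; exact h1.1
    have hg0 : 0 ≤ g N := by
      rw [hg]; dsimp only; positivity
    have hgN : g N ≤ (N : ℝ) ^ 2 := by
      have h5 : Real.log (1 / (p N : ℝ)) ≤ 1 / p N := Real.log_le_self (by positivity)
      calc g N ≤ (N : ℝ) ^ 2 * (p N : ℝ) ^ 2 * (1 / p N) := by
            rw [hg]; dsimp only; gcongr
        _ = (N : ℝ) ^ 2 * p N := by field_simp
        _ ≤ (N : ℝ) ^ 2 * 1 := by gcongr; exact (hp1 N).le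
        _ = _ := mul_one _
    refine binomialRandom_upper_le (m := m) (k := ⌊2 * (c * g N) / τ ^ 2⌋₊) (u := c * g N) (τ := τ)
      hq (hp1 N) hN hα.le (by linarith) h1.1 hs.le ?_ ?_ hL rfl ?_ hτ0
      (natFloor_le_bounds hτ0) ?_ ?_
    · have := ha0 N
      have := hb0 N
      positivity
    · rw [le_div_iff₀ (by positivity)] at h2; linarith
    · calc 2 * (c * g N) = 2 * c * g N := by ring
        _ ≤ N * (N : ℝ) ^ 2 := mul_le_mul hNc hgN hg0 hN0.le
        _ ≤ N * (N : ℝ) ^ 2 * N := le_mul_of_one_le_right (by positivity) (by linarith)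
        _ = _ := by ring
    · have e1 := bulk_term_eq hN0 hq hC0 (show 0 < α by linarith)
      have e2 := upper_tail_term_eq hN0 hq hl hα (b := b N) rfl
      have e3 : (τ ^ (α - 2) * (2 * (c * g N))) ^ (1 / α) ≤
          N * p N * (2 * c * b N ^ ((α - 2) / 2)) ^ (1 / α) := by
        refine tail_term_le (by positivity) (by linarith) (by positivity) (by positivity) ?_ e2
        calc τ ^ (α - 2) * (2 * (c * g N)) ≤
            τ ^ (α - 2) * (2 * (c * ((N : ℝ) ^ 2 * (p N : ℝ) ^ 2 * Real.log N))) := by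
              rw [hg]; dsimp only; gcongr
          _ = _ := by ring
      rw [e1]
      have h3 := h1.2
      calc _ ≤ (N : ℝ) * (p N : ℝ) * (C ^ (1 / α) * a N ^ (1 / 2 : ℝ)) +
          (N * p N * (2 * c * b N ^ ((α - 2) / 2)) ^ (1 / α) + N * p N * a N) :=
            add_le_add le_rfl (add_le_add e3 h3)
        _ = _ := by ring
    · have h5 : (⌊2 * (c * g N) / τ ^ 2⌋₊ : ℝ) ≤ 2 * (c * g N) / τ ^ 2 :=
        Nat.floor_le (by positivity)
      calc _ = 1 + 14 * (N * Real.log N) * (⌊2 * (c * g N) / τ ^ 2⌋₊ : ℝ) := by ring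
        _ ≤ 1 + 14 * (N * Real.log N) * (2 * (c * g N) / τ ^ 2) := by gcongr
        _ = _ := by rw [hτ2]; field_simp; ring

theorem lower_tail (α : ℝ) (hα : 2 < α) (p : ℕ → I)
    (hp0 : ∀ N, 0 < (p N : ℝ))
    (hp : Tendsto (fun N => (p N : ℝ)) atTop (𝓝 0))
    (hlarge : (fun N : ℕ => (Real.log N / N) ^ ((α - 2) / (2 * α - 2))) =o[atTop]
      fun N => (p N : ℝ))
    (s : ℝ) (hs : 0 ≤ s) : ∃ ε E : ℕ → ℝ,
        Tendsto ε atTop (𝓝 0) ∧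
        (E =o[atTop] fun N : ℕ => (N : ℝ) ^ 2 * (p N : ℝ)) ∧
        ∀ᶠ N : ℕ in atTop,
          SimpleGraph.binomialRandom (Fin N) (p N)
              {G | schattenFun α N (adj G) ≤ N * (s * p N)} ≤
            EReal.exp
              (-psi (schattenFun α N) (p N) (N * ((s + ε N) * p N)) + (E N : EReal)) := by
  set b : ℕ → ℝ := fun N => (Real.log N / N) ^ ((α - 2) / (2 * α - 2)) / p N with hb
  have hbt : Tendsto b atTop (𝓝 0) := hlarge.tendsto_div_nhds_zero
  have hlog0 : ∀ N : ℕ, 0 ≤ Real.log N := fun N => Real.log_natCast_nonneg N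
  have hb0 : ∀ N, 0 ≤ b N := fun N => div_nonneg (Real.rpow_nonneg
    (div_nonneg (hlog0 N) (Nat.cast_nonneg N)) _) (hp0 N).le
  set g : ℕ → ℝ := fun N => (N : ℝ) ^ 2 * (p N : ℝ) with hg
  have hγ : 0 < (α - 1) / (α - 2) := div_pos (by linarith) (by linarith)
  have hθ : 0 < (α - 2) / (2 * α - 2) := div_pos (by linarith) (by linarith)
  have hθ1 : (α - 2) / (2 * α - 2) ≤ 1 := by rw [div_le_one (by linarith)]; linarith
  have hNp : ∀ᶠ N : ℕ in atTop, 1 ≤ N * (p N : ℝ) ∧ 1 ≤ N * (p N : ℝ) * b N := by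
    filter_upwards [hbt.eventually (ge_mem_nhds zero_lt_one), eventually_ge_atTop 3] with N h1 h2
    have hN : (3 : ℝ) ≤ N := by exact_mod_cast h2
    have hl1 : 1 ≤ Real.log N := by
      rw [Real.le_log_iff_exp_le (by linarith)]
      linarith [Real.exp_one_lt_d9]
    have h3 : N * (p N : ℝ) * b N = N * (Real.log N / N) ^ ((α - 2) / (2 * α - 2)) := by
      rw [hb]
      have := (hp0 N).ne'
      field_simp
    have h4 : (1 : ℝ) ≤ N * (Real.log N / N) ^ ((α - 2) / (2 * α - 2)) := by
      have h5 : (1 : ℝ) / N ≤ (Real.log N / N) ^ ((α - 2) / (2 * α - 2)) := by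
        calc (1 : ℝ) / N = (1 / N : ℝ) ^ (1 : ℝ) := (Real.rpow_one _).symm
          _ ≤ (1 / N : ℝ) ^ ((α - 2) / (2 * α - 2)) :=
              Real.rpow_le_rpow_of_exponent_ge (by positivity)
                (by rw [div_le_one (by linarith)]; linarith) hθ1
          _ ≤ _ := by
              refine Real.rpow_le_rpow (by positivity) ?_ hθ.le
              gcongr
      rw [div_le_iff₀ (by linarith)] at h5
      linarith
    have h5 : 0 ≤ N * (p N : ℝ) := mul_nonneg (by linarith) (hp0 N).le
    refine ⟨?_, by rw [h3]; exact h4⟩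
    rw [← h3] at h4
    nlinarith [hb0 N]
  have hgt : Tendsto g atTop atTop := by
    refine tendsto_atTop_mono' _ ?_ (tendsto_natCast_atTop_atTop (R := ℝ))
    filter_upwards [hNp] with N h1
    rw [hg]; dsimp only
    nlinarith [Nat.cast_nonneg (α := ℝ) N]
  -- No fluctuation term is needed here: ε collects only truncation and rounding. The constant 56 is
  -- 14 · 4, with k at most 4g / τ².
  refine ⟨fun N => 2 * ((4 * b N ^ ((α - 1) / 2)) ^ (1 / α) + b N),
    fun N => 1 + 56 * b N ^ ((α - 1) / (α - 2)) * g N, ?_, ?_, ?_⟩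
  · have h2 := tendsto_rpow_zero (((tendsto_rpow_zero hbt (r := (α - 1) / 2)
      (by linarith)).const_mul 4).trans (by simp)) (r := 1 / α) (by positivity)
    have h3 := (h2.add hbt).const_mul 2
    simpa using h3
  · refine IsLittleO.add (isLittleO_const_left.2 (Or.inr ?_)) ?_
    · exact tendsto_norm_atTop_atTop.comp hgt
    · have h1 : (fun N => 56 * b N ^ ((α - 1) / (α - 2))) =o[atTop] fun _ : ℕ => (1 : ℝ) := by
        rw [isLittleO_one_iff]
        simpa using (tendsto_rpow_zero hbt hγ).const_mul 56
      simpa using h1.mul_isBigO (isBigO_refl g atTop)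
  · have hp2 : ∀ᶠ N in atTop, (p N : ℝ) ≤ 1 / 2 := hp.eventually (ge_mem_nhds (by norm_num))
    filter_upwards [hNp, hp2, eventually_ge_atTop 3] with N h1 h2 hN
    have hN3 : (3 : ℝ) ≤ N := by exact_mod_cast hN
    have hN0 : (0 : ℝ) < N := by linarith
    have hl : 0 < Real.log N := Real.log_pos (by linarith)
    have hq := hp0 N
    have hbpos : 0 < b N := by
      rw [hb]; dsimp only
      have := Real.rpow_pos_of_pos (div_pos hl hN0) ((α - 2) / (2 * α - 2))
      positivity
    have hbγ : 0 < b N ^ ((α - 1) / (α - 2)) := Real.rpow_pos_of_pos hbpos _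
    set τ := Real.sqrt (N * Real.log N / b N ^ ((α - 1) / (α - 2))) with hτ
    have hτ0 : 0 < τ := Real.sqrt_pos.2 (by positivity)
    have hτ2 : τ ^ 2 = N * Real.log N / b N ^ ((α - 1) / (α - 2)) := Real.sq_sqrt (by positivity)
    have hg0 : 0 ≤ g N := by
      rw [hg]; dsimp only; positivity
    refine binomialRandom_lower_le (k := ⌊4 * g N / τ ^ 2⌋₊) (τ := τ)
      hq h2 hN hα.le hs ?_ hτ0 (natFloor_le_bounds hτ0) ?_ ?_
    · have := hb0 N
      positivity
    · have e2 := lower_tail_term_eq hN0 hq hl hα (b := b N) rfl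
      have e3 : (τ ^ (α - 2) * (4 * g N)) ^ (1 / α) ≤
          N * p N * (4 * b N ^ ((α - 1) / 2)) ^ (1 / α) := by
        refine tail_term_le (by positivity) (by linarith) (by positivity) (by positivity)
          (le_of_eq ?_) e2
        rw [hg]; ring
      have h3 := h1.2
      calc _ ≤ (N : ℝ) * (p N : ℝ) * (4 * b N ^ ((α - 1) / 2)) ^ (1 / α) + N * p N * b N :=
            add_le_add e3 h3
        _ = _ := by ring
    · have h5 : (⌊4 * g N / τ ^ 2⌋₊ : ℝ) ≤ 4 * g N / τ ^ 2 := Nat.floor_le (by positivity)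
      calc _ = 1 + 14 * (N * Real.log N) * (⌊4 * g N / τ ^ 2⌋₊ : ℝ) := by ring
        _ ≤ 1 + 14 * (N * Real.log N) * (4 * g N / τ ^ 2) := by gcongr
        _ = _ := by rw [hτ2]; field_simp; ring

end Asymptotics

end SchattenLD

theorem proposition1p5 (α : ℝ) (hα : 2 < α) (p : ℕ → unitInterval)
    (hp0 : ∀ N, 0 < (p N : ℝ)) (hp1 : ∀ N, (p N : ℝ) < 1)
    (hp : Tendsto (fun N => (p N : ℝ)) atTop (𝓝 0)) :
    -- upper tail
    (((fun N : ℕ => max ((N : ℝ) ^ (2 / α - 1))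
          (Real.log N ^ (α / (2 * α - 4)) / Real.sqrt N)) =o[atTop] fun N => (p N : ℝ)) →
      ∀ s : ℝ, 1 < s → ∃ ε E : ℕ → ℝ,
        Tendsto ε atTop (𝓝 0) ∧
        (E =o[atTop] fun N : ℕ => (N : ℝ) ^ 2 * (p N : ℝ) ^ 2 * Real.log (1 / (p N : ℝ))) ∧
        ∀ᶠ N : ℕ in atTop,
          SimpleGraph.binomialRandom (Fin N) (p N)
              {G | N * (s * p N) ≤ SchattenLD.schattenFun α N (SchattenLD.adj G)} ≤
            EReal.exp
              (-SchattenLD.phi (SchattenLD.schattenFun α N) (p N) (N * ((s - ε N) * p N)) +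
                (E N : EReal))) ∧
    -- lower tail
    (((fun N : ℕ => (Real.log N / N) ^ ((α - 2) / (2 * α - 2))) =o[atTop] fun N => (p N : ℝ)) →
      ∀ s : ℝ, 0 ≤ s → s < 1 → ∃ ε E : ℕ → ℝ,
        Tendsto ε atTop (𝓝 0) ∧
        (E =o[atTop] fun N : ℕ => (N : ℝ) ^ 2 * (p N : ℝ)) ∧
        ∀ᶠ N : ℕ in atTop,
          SimpleGraph.binomialRandom (Fin N) (p N)
              {G | SchattenLD.schattenFun α N (SchattenLD.adj G) ≤ N * (s * p N)} ≤
            EReal.exp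
              (-SchattenLD.psi (SchattenLD.schattenFun α N) (p N) (N * ((s + ε N) * p N)) +
                (E N : EReal))) := by
  exact ⟨SchattenLD.upper_tail α hα p hp0 hp1 hp,
    fun h s hs _ => SchattenLD.lower_tail α hα p hp0 hp h s hs⟩
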